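/- **Conventions.** Let $\mathbb S^1=\mathbb R/\mathbb Z$ with its arc-length distance (total length $1$) and its usual cyclic order. A *cyclic order* on a set $X$ is a function $c:X^3\to\{0,\pm1\}$ such that $c(x_1,x_2,x_3)=0$ if and only if $x_i=x_j$ for some $i\ne j$, and $$c(x_2,x_3,x_4)-c(x_1,x_3,x_4)+c(x_1,x_2,x_4)-c(x_1,x_2,x_3)=0$$ for all $x_1,\dots,x_4\in X$; a map is *cyclic-order-preserving* if it preserves the value of $c$ on every triple. A *cyclically ordered $G$-set* is a cyclically ordered set on which $G$ acts by cyclic-order-preserving maps. A $G$-set $X$ has *subexponential growth of orbits* if $\lim_{n\to\infty}|S^nx|^{1/n}=1$ for every nonempty finite $S\subset G$ and every $x\in X$, where $S^n$ is the set of products of $n$ elements of $S$ and $S^nx=\{gx: g\in S^n\}$. A *modulus of continuity* is a homeomorphism $\sigma:[0,\infty)\to[0,\infty)$. $\mathrm{Diff}^{1,\sigma}_+(\mathbb S^1)$ is the set of orientation-preserving $C^1$ diffeomorphisms $f$ of $\mathbb S^1$ whose derivative $Df:\mathbb S^1\to\mathbb R$ satisfies $\sup_{\xi\neq\eta}|Df(\xi)-Df(\eta)|/\sigma(d(\xi,\eta))<\infty$.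 An *open interval* of $\mathbb S^1$ is the projection of an interval $(a,b)\subset\mathbb R$ with $a<b\le a+1$; its left and right endpoints are the projections of $a$ and $b$. **Proposition 4.1.** Let $G$ be a countable group and let $(X,c)$ be a nonempty countable cyclically ordered $G$-set with subexponential growth of orbits. Let $F:\mathbb N\to[1,+\infty)$ be a non-decreasing function such that $\lim_{n\to\infty}F(n+1)/F(n)=1$ and such that, for every finite subset $S\subset G$ and every $x\in X$, $$\sum_n\frac{|S^nx|}{F(n)}<+\infty .$$ Let $\sigma$ be a modulus of continuity such that $t\mapsto\sigma(t)/t$ is decreasing (not necessarily strictly) on $(0,\infty)$ and $$\limsup_{n\to\infty}\left|\frac{F(n+1)}{F(n)}-1\right|\cdot\frac1{\sigma(F(n)^{-1})}<+\infty .$$ Then for every finite subset $S\subset G$ and every $\varepsilon>0$ there exist a homomorphism $\rho$ from $G$ to the group of homeomorphisms of $\mathbb S^1$, with $\rho(g)\in\mathrm{Diff}^{1,\sigma}_+(\mathbb S^1)$ for all $g\in G$, and a family $(J_x)_{x\in X}$ of nonempty open intervals of $\mathbb S^1$ such that: 1. $J_x\cap J_y=\emptyset$ whenever $x\neq y$,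 and $\bigcup_{x\in X}J_x$ is dense in $\mathbb S^1$; 2. the map $X\to\mathbb S^1$ that sends $x$ to the left endpoint of $J_x$ is cyclic-order-preserving, and so is the one that sends $x$ to the right endpoint; 3. $\rho(g)(J_x)=J_{gx}$ for all $g\in G$ and $x\in X$, and if $gx=x$ then $\rho(g)$ is the identity on $J_x$; 4. $\sup_{\xi\in\mathbb S^1}|D\rho(s)(\xi)-1|<\varepsilon$ for every $s\in S$. -/

import Mathlib

open Filter Topology
open scoped NNReal Pointwise

namespace CircleAction

/-! ### Cyclic orders -/

/-- A cyclic order on `X`: a function `c : X × X × X → {0, ±1}` that vanishes exactly on the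
degenerate triples and satisfies the cocycle relation. -/
structure CyclicOrder (X : Type*) where
  c : X → X → X → SignType
  eq_zero_iff : ∀ x₁ x₂ x₃, c x₁ x₂ x₃ = 0 ↔ x₁ = x₂ ∨ x₁ = x₃ ∨ x₂ = x₃
  cocycle : ∀ x₁ x₂ x₃ x₄,
    (c x₂ x₃ x₄ : ℤ) - (c x₁ x₃ x₄ : ℤ) + (c x₁ x₂ x₄ : ℤ) - (c x₁ x₂ x₃ : ℤ) = 0

/-- A map between cyclically ordered sets is cyclic-order-preserving if it preserves the value
of the cyclic order on every triple. -/
def CyclicOrderPreserving {X Y : Type*} (cX : CyclicOrder X) (cY : CyclicOrder Y)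
    (f : X → Y) : Prop :=
  ∀ x₁ x₂ x₃, cY.c (f x₁) (f x₂) (f x₃) = cX.c x₁ x₂ x₃

open Classical in
/-- The cyclic order given by a circular order in the sense of Mathlib: it is `1` on a triple
`(a, b, d)` in strict cyclic position, and `-1` on a triple whose reverse is. -/
noncomputable def CyclicOrder.ofCircularOrder (X : Type*) [CircularOrder X] : CyclicOrder X where
  c a b d := if sbtw a b d then 1 else if sbtw d b a then -1 else 0
  eq_zero_iff a b d := by
    have h1 : sbtw a b d → ¬ (a = b ∨ a = d ∨ b = d) := by
      rintro h (rfl | rfl | rfl)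
      · exact sbtw_irrefl_left h
      · exact sbtw_irrefl_left_right h
      · exact sbtw_irrefl_right h
    have h2 : sbtw d b a → ¬ (a = b ∨ a = d ∨ b = d) := by
      rintro h (rfl | rfl | rfl)
      · exact sbtw_irrefl_right h
      · exact sbtw_irrefl_left_right h
      · exact sbtw_irrefl_left h
    have h3 : ¬ sbtw a b d → ¬ sbtw d b a → (a = b ∨ a = d ∨ b = d) := by
      intro h h'
      rw [sbtw_iff_not_btw, not_not] at h h'
      rcases btw_antisymm h' h with h | h | h <;> simp [h]
    split_ifs <;> simp_all
  cocycle a b d e := by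
    set c : X → X → X → SignType :=
      fun a b d => if sbtw a b d then 1 else if sbtw d b a then -1 else 0 with hc
    change (c b d e : ℤ) - (c a d e : ℤ) + (c a b e : ℤ) - (c a b d : ℤ) = 0
    have cyc : ∀ {x y z : X}, sbtw x y z → sbtw y z x := fun h => h.cyclic_left
    have asy : ∀ {x y z : X}, sbtw x y z → ¬ sbtw z y x := fun h => sbtw_asymm h
    have tr : ∀ {x y z w : X}, sbtw x y z → sbtw y w z → sbtw x w z :=
      fun h h' => sbtw_trans_left h h'
    have tot : ∀ {x y z : X}, ¬ sbtw x y z → ¬ sbtw z y x → (x = y ∨ y = z ∨ z = x) := by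
      intro x y z h h'
      rw [sbtw_iff_not_btw, not_not] at h h'
      exact btw_antisymm h' h
    have irr : ∀ {x y : X}, ¬ sbtw x y x := sbtw_irrefl_left_right
    have irr1 : ∀ {x y : X}, ¬ sbtw x x y := sbtw_irrefl_left
    have irr2 : ∀ {x y : X}, ¬ sbtw y x x := sbtw_irrefl_right
    have hcast : ∀ x y z : X, (c x y z : ℤ) =
        if sbtw x y z then 1 else if sbtw z y x then -1 else 0 := by
      intro x y z
      simp only [hc]
      split_ifs <;> rfl
    clear_value c
    rw [hcast, hcast, hcast, hcast]
    by_cases hab : a = b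
    · subst hab; simp [irr1, irr2]
    by_cases had : a = d
    · subst had; grind
    by_cases hae : a = e
    · subst hae; grind
    by_cases hbd : b = d
    · subst hbd; grind
    by_cases hbe : b = e
    · subst hbe; grind
    by_cases hde : d = e
    · subst hde; grind
    grind

/-! ### The circle `𝕊¹ = ℝ/ℤ`, its intervals and its diffeomorphisms -/

/-- The usual (counterclockwise) cyclic order of the circle `ℝ/ℤ`. -/
noncomputable def circleOrder : CyclicOrder UnitAddCircle :=
  CyclicOrder.ofCircularOrder UnitAddCircle

/-- A nonempty open interval of the circle, with its left and right endpoints: the projection of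
an open interval of `ℝ` of length at most `1`. (For length `1` it is the complement of a point,
and this point is both its left and its right endpoint.) -/
structure OpenInterval where
  a : ℝ
  b : ℝ
  lt : a < b
  le : b ≤ a + 1

namespace OpenInterval

/-- The set of points of an open interval of the circle. -/
def carrier (J : OpenInterval) : Set UnitAddCircle :=
  (fun t : ℝ => (t : UnitAddCircle)) '' Set.Ioo J.a J.b

/-- The left endpoint. -/
def left (J : OpenInterval) : UnitAddCircle := (J.a : UnitAddCircle)

/-- The right endpoint. -/
def right (J : OpenInterval) : UnitAddCircle := (J.b : UnitAddCircle)

end OpenInterval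

/-- The representative in `(-1/2, 1/2]` of a point of `ℝ/ℤ`; near `0` it is the inverse of the
projection `ℝ → ℝ/ℤ`. -/
noncomputable def signedRep (ξ : UnitAddCircle) : ℝ :=
  (AddCircle.equivIoc (1 : ℝ) (-(1 / 2)) ξ : ℝ)

/-- The expression of a circle map `f` around `ξ` in the additive coordinates `h ↦ ξ + h` at the
source and `h ↦ f ξ + h` at the target. -/
noncomputable def localExpr (f : UnitAddCircle → UnitAddCircle) (ξ : UnitAddCircle) (h : ℝ) : ℝ :=
  signedRep (f (ξ + (h : UnitAddCircle)) - f ξ)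

/-- Differentiability of a circle map at a point. -/
def CircleDifferentiableAt (f : UnitAddCircle → UnitAddCircle) (ξ : UnitAddCircle) : Prop :=
  DifferentiableAt ℝ (localExpr f ξ) 0

/-- The derivative `D f : 𝕊¹ → ℝ` of a circle map. -/
noncomputable def circleDeriv (f : UnitAddCircle → UnitAddCircle) (ξ : UnitAddCircle) : ℝ :=
  deriv (localExpr f ξ) 0

/-- Circle maps of class `C¹`. -/
def IsCircleC1 (f : UnitAddCircle → UnitAddCircle) : Prop :=
  (∀ ξ, CircleDifferentiableAt f ξ) ∧ Continuous (circleDeriv f)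

/-- `Diff₊¹(𝕊¹)`: the orientation-preserving `C¹` diffeomorphisms of the circle, as a set of
elements of the group of homeomorphisms of the circle. -/
def DiffPlus : Set (UnitAddCircle ≃ₜ UnitAddCircle) :=
  {f | IsCircleC1 f ∧ IsCircleC1 f.symm ∧ ∀ ξ, 0 < circleDeriv f ξ}

/-- The class `C^σ` of functions between metric spaces, for a modulus of continuity `σ`, that is,
a homeomorphism of `[0, ∞)`: the `C^σ`-norm
`sup_{x ≠ y} d(f(x), f(y)) / σ(d(x, y))` is finite. -/
def InClass {A B : Type*} [MetricSpace A] [MetricSpace B] (σ : ℝ≥0 ≃ₜ ℝ≥0) (f : A → B) : Prop :=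
  BddAbove {r : ℝ | ∃ x y : A, x ≠ y ∧ r = dist (f x) (f y) / (σ (nndist x y) : ℝ)}

/-- `Diff₊^{1,σ}(𝕊¹)`: the orientation-preserving `C¹` diffeomorphisms of the circle whose
derivative is in the class `C^σ`. -/
def DiffPlusMod (σ : ℝ≥0 ≃ₜ ℝ≥0) : Set (UnitAddCircle ≃ₜ UnitAddCircle) :=
  {f | f ∈ DiffPlus ∧ InClass σ (circleDeriv f)}

/-! ### Growth of orbits -/

/-- `|Sⁿ x|`, where `Sⁿ` is the set of products of `n` elements of `S`. -/
noncomputable def orbitGrowth {G X : Type*} [Group G] [MulAction G X] (S : Finset G) (x : X)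
    (n : ℕ) : ℕ :=
  ((fun g : G => g • x) '' ((S : Set G) ^ n)).ncard

/-- Subexponential growth of orbits: `|Sⁿ x|^(1/n) → 1` for every nonempty finite `S ⊆ G` and
every `x`. (For `S = ∅` one has `|Sⁿ x| = 0` for all `n ≥ 1`.) -/
def SubexpGrowthOfOrbits (G X : Type*) [Group G] [MulAction G X] : Prop :=
  ∀ (S : Finset G) (x : X), S.Nonempty →
    Tendsto (fun n : ℕ => (orbitGrowth S x n : ℝ) ^ (1 / (n : ℝ))) atTop (𝓝 1)

end CircleAction

namespace CircleAction

/-! ### Circle maps and their lifts -/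

/-! Each point `x` of `X` receives an interval of length `l x`, with total length 1. The intervals
are laid out in the linear order obtained by cutting the cyclic order at a point `x₀`. An element
`g` sends the interval of `x` to that of `g • x` by a map from Yoccoz's family, which is equivariant
(`yoccozMap_comp`) and has derivative 1 at both ends. These derivatives therefore glue to a
continuous density, and the circle map is obtained by integrating it. Since the intervals have full
measure, they are dense and the integral is a sum of lengths. `coe_leftPos_equiv` then shows that
every interval lands where it should modulo 1. The group law holds on the intervals, hence
everywhere by density and continuity (`exists_action`).

Regularity comes from the lengths. With `q = l x / l (g • x)`, Yoccoz's derivative is Lipschitz with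
constant of order `|q ^ 2 - 1| / l x`. If `|q - 1| ≤ B * τ (l x)`, then, because `τ t / t`
decreases, `τ (l x) / l x * |u - v| ≤ τ |u - v|` inside an interval, so the derivative has modulus
`τ` uniformly in `x`.

The lengths are `1 / F (ν x + k)`, normalized (`exists_lengths`). The level `ν` changes by a bounded
amount under each group element, while `∑ 1 / F (ν x)` converges (`exists_level`). Bounded change of
level turns the hypothesis on `F (n + 1) / F n` into the bound on `q`. Taking `k` large brings `q`
close to 1 for the elements of `S`, and hence the derivatives too. -/

lemma signedRep_coe {u : ℝ} (hu : u ∈ Set.Ioc (-(1 / 2) : ℝ) (1 / 2)) :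
    signedRep (u : UnitAddCircle) = u := by
  unfold signedRep
  change toIocMod _ _ u = u
  rw [toIocMod_eq_self]
  constructor
  · exact hu.1
  · linarith [hu.2]

/-- Near 0 the signed representative inverts the projection, so the local expression agrees there
with `h ↦ H (t + h) - H t`. -/
lemma hasDerivAt_localExpr {f : UnitAddCircle → UnitAddCircle} {H : ℝ → ℝ}
    (hf : ∀ t : ℝ, f t = (H t : UnitAddCircle)) {t d : ℝ} (hH : HasDerivAt H d t) :
    HasDerivAt (localExpr f t) d 0 := by
  have h1 : HasDerivAt (fun h : ℝ => H (t + h) - H t) d 0 := by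
    have h2 : HasDerivAt H d (t + 0) := by simpa using hH
    have h3 := (h2.comp_const_add t 0).sub_const (H t)
    exact h3
  refine h1.congr_of_eventuallyEq ?_
  have h2 : Tendsto (fun h : ℝ => H (t + h) - H t) (𝓝 0) (𝓝 0) := by
    simpa using h1.continuousAt.tendsto
  have h3 : Set.Ioc (-(1 / 2) : ℝ) (1 / 2) ∈ 𝓝 (0 : ℝ) :=
    Ioc_mem_nhds (by norm_num) (by norm_num)
  filter_upwards [h2 h3] with h hh
  have : f ((t : UnitAddCircle) + (h : UnitAddCircle)) - f t
      = ((H (t + h) - H t : ℝ) : UnitAddCircle) := by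
    rw [← AddCircle.coe_add, hf, hf, AddCircle.coe_sub]
  rw [localExpr, this, signedRep_coe hh]

lemma circleDeriv_coe {f : UnitAddCircle → UnitAddCircle} {H : ℝ → ℝ}
    (hf : ∀ t : ℝ, f t = (H t : UnitAddCircle)) {t d : ℝ} (hH : HasDerivAt H d t) :
    circleDeriv f t = d :=
  (hasDerivAt_localExpr hf hH).deriv

lemma isCircleC1_of_lift {f : UnitAddCircle → UnitAddCircle} {H D : ℝ → ℝ}
    (hf : ∀ t : ℝ, f t = (H t : UnitAddCircle)) (hH : ∀ t, HasDerivAt H (D t) t)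
    (hD : Continuous D) : IsCircleC1 f := by
  constructor
  · intro ξ
    induction ξ using QuotientAddGroup.induction_on with
    | H t => exact (hasDerivAt_localExpr hf (hH t)).differentiableAt
  · have : Continuous ((circleDeriv f) ∘ ((↑) : ℝ → UnitAddCircle)) := by
      refine hD.congr fun t => ?_
      exact (circleDeriv_coe hf (hH t)).symm
    exact (QuotientAddGroup.isQuotientMap_mk (N := AddSubgroup.zmultiples (1 : ℝ))).continuous_iff.2 this

/-- Choosing the lift nearest to `t` carries estimates for lifts on `ℝ` over to the circle distance.
-/
lemma exists_lift_dist (ξ : UnitAddCircle) (t : ℝ) :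
    ∃ s : ℝ, (s : UnitAddCircle) = ξ ∧ |s - t| = dist ξ (t : UnitAddCircle) := by
  induction ξ using QuotientAddGroup.induction_on with
  | H r =>
    refine ⟨r - round (r - t), ?_, ?_⟩
    · rw [AddCircle.coe_sub, sub_eq_self, AddCircle.coe_eq_zero_iff]
      exact ⟨round (r - t), by simp⟩
    · rw [dist_eq_norm, ← QuotientAddGroup.mk_sub]
      have := UnitAddCircle.norm_eq (x := r - t)
      refine Eq.trans ?_ this.symm
      congr 1; ring

/-- At mutual distance less than 1, no two of the reals differ by a nonzero integer, so the cyclic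
position is the linear one up to rotation. -/
lemma sbtw_coe_iff {a b d : ℝ} (hab : |a - b| < 1) (hbd : |b - d| < 1) (had : |a - d| < 1) :
    sbtw (a : UnitAddCircle) b d ↔ a < b ∧ b < d ∨ b < d ∧ d < a ∨ d < a ∧ a < b := by
  rw [sbtw_iff_not_btw]
  have key : ∀ u v : ℝ, |u - v| < 1 →
      toIcoMod (one_pos : (0 : ℝ) < 1) u v = if u ≤ v then v else v + 1 := by
    intro u v h
    rw [abs_lt] at h
    split_ifs with h'
    · rw [toIcoMod_eq_self]; constructor <;> linarith
    · rw [← toIcoMod_add_right, toIcoMod_eq_self]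
      constructor <;> linarith
  have key2 : ∀ u v : ℝ, |u - v| < 1 →
      toIocMod (one_pos : (0 : ℝ) < 1) u v = if u < v then v else v + 1 := by
    intro u v h
    rw [abs_lt] at h
    split_ifs with h'
    · rw [toIocMod_eq_self]; constructor <;> linarith
    · rw [← toIocMod_add_right, toIocMod_eq_self]
      constructor <;> linarith
  have hb : btw (d : UnitAddCircle) b a ↔ toIcoMod (one_pos : (0 : ℝ) < 1) d b
      ≤ toIocMod (one_pos : (0 : ℝ) < 1) d a := QuotientAddGroup.btw_coe_iff
  rw [hb, key d b (by rwa [abs_sub_comm]), key2 d a (by rwa [abs_sub_comm])]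
  rw [abs_lt] at *
  split_ifs <;> grind

/-- A map between cyclically ordered sets is order preserving as soon as it preserves the
positive triples. -/
lemma circleOrder_preserving {X : Type*} (c : CyclicOrder X) (f : X → ℝ)
    (hf : ∀ x y, |f x - f y| < 1)
    (h1 : ∀ x y z, c.c x y z = 1 ↔ f x < f y ∧ f y < f z ∨ f y < f z ∧ f z < f x ∨
      f z < f x ∧ f x < f y)
    (h2 : ∀ x y z, c.c x y z = -1 ↔ f z < f y ∧ f y < f x ∨ f y < f x ∧ f x < f z ∨
      f x < f z ∧ f z < f y) :
    CyclicOrderPreserving c circleOrder (fun x => (f x : UnitAddCircle)) := by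
  classical
  intro x y z
  have e : circleOrder.c (f x : UnitAddCircle) (f y) (f z) =
    if sbtw (f x : UnitAddCircle) (f y) (f z) then 1 else
      if sbtw (f z : UnitAddCircle) (f y) (f x) then -1 else 0 := by
    simp only [circleOrder, CyclicOrder.ofCircularOrder]
  rw [e, sbtw_coe_iff (hf _ _) (hf _ _) (hf _ _), sbtw_coe_iff (hf _ _) (hf _ _) (hf _ _),
    ← h1 x y z, ← h2]
  rcases SignType.trichotomy (c.c x y z) with h | h | h <;> simp [h]

/-! ### The linear order cut from a cyclic order -/

namespace CyclicOrder

variable {X : Type*} (c : CyclicOrder X)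

/-- The cocycle relation on `x, y, z, x` has two degenerate terms, and what remains is this
identity. `swap` follows in the same way from `x, y, x, z`. -/
lemma rotate (x y z : X) : c.c y z x = c.c x y z := by
  have h := c.cocycle x y z x
  rw [(c.eq_zero_iff x z x).2 (by simp), (c.eq_zero_iff x y x).2 (by simp)] at h
  generalize c.c y z x = u at *
  generalize c.c x y z = v at *
  revert u v; decide

lemma swap (x y z : X) : c.c y x z = -c.c x y z := by
  have h := c.cocycle x y x z
  rw [(c.eq_zero_iff x x z).2 (by simp), (c.eq_zero_iff x y x).2 (by simp)] at h
  generalize c.c y x z = u at *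
  generalize c.c x y z = v at *
  revert u v; decide

/-- The linear order on `X` with smallest element `x₀` obtained by cutting `c` before `x₀`. -/
def Prec (x₀ x y : X) : Prop := c.c x₀ x y = 1 ∨ (x = x₀ ∧ y ≠ x₀)

variable {c} {x₀ : X}

lemma Prec.irrefl (x : X) : ¬ c.Prec x₀ x x := by
  rintro (h | ⟨h, h'⟩)
  · rw [(c.eq_zero_iff x₀ x x).2 (by simp)] at h; exact absurd h (by decide)
  · exact h' h

lemma Prec.asymm {x y : X} (h : c.Prec x₀ x y) : ¬ c.Prec x₀ y x := by
  have h1 := c.rotate x₀ x y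
  have h2 := c.swap x y x₀
  have h3 := c.rotate x₀ y x
  have h4 := c.eq_zero_iff x₀ x y
  have h5 := c.eq_zero_iff x₀ y x
  unfold Prec at *
  generalize c.c x₀ x y = u at *
  generalize c.c x₀ y x = v at *
  rw [h1, h3] at h2
  subst h2
  have n1 : ¬ (-1 : SignType) = 1 := by decide
  have n2 : ¬ (0 : SignType) = 1 := by decide
  have n3 : ¬ (-0 : SignType) = 1 := by decide
  have n4 : ¬ (- -1 : SignType) = 0 := by decide
  have n5 : ¬ (-1 : SignType) = 0 := by decide
  rcases SignType.trichotomy u with rfl | rfl | rfl <;> grind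

lemma Prec.total {x y : X} (h : x ≠ y) : c.Prec x₀ x y ∨ c.Prec x₀ y x := by
  have h1 := c.rotate x₀ x y
  have h2 := c.swap x y x₀
  have h3 := c.rotate x₀ y x
  have h4 := c.eq_zero_iff x₀ x y
  unfold Prec at *
  generalize c.c x₀ x y = u at *
  generalize c.c x₀ y x = v at *
  rw [h1, h3] at h2
  subst h2
  rcases SignType.trichotomy u with rfl | rfl | rfl
  · right; left; rfl
  · have := h4.1 rfl
    grind
  · left; left; rfl

lemma Prec.trans {x y z : X} (h : c.Prec x₀ x y) (h' : c.Prec x₀ y z) : c.Prec x₀ x z := by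
  rcases h with h | ⟨h, hy⟩
  · rcases h' with h' | ⟨h', hz⟩
    · left
      have e := c.cocycle x₀ x y z
      rw [h, h'] at e
      generalize c.c x₀ x z = u at *
      generalize c.c x y z = v at *
      revert u v; decide
    · subst h'
      rw [(c.eq_zero_iff y x y).2 (by simp)] at h
      exact absurd h (by decide)
  · subst h
    right
    refine ⟨rfl, ?_⟩
    rintro rfl
    rcases h' with h' | ⟨h', hz⟩
    · rw [(c.eq_zero_iff z y z).2 (by simp)] at h'
      exact absurd h' (by decide)
    · exact hz rfl

/-- The linear order cut from a cyclic order recovers the cyclic order. -/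
lemma c_eq_one_iff (x y z : X) : c.c x y z = 1 ↔ c.Prec x₀ x y ∧ c.Prec x₀ y z ∨
    c.Prec x₀ y z ∧ c.Prec x₀ z x ∨ c.Prec x₀ z x ∧ c.Prec x₀ x y := by
  have fwd : ∀ x y z, c.Prec x₀ x y ∧ c.Prec x₀ y z → c.c x y z = 1 := by
    rintro x y z ⟨h, h'⟩
    have h2 := h.trans h'
    rcases h' with h' | ⟨h', hz⟩
    · rcases h with h | ⟨h, hy⟩
      · rcases h2 with h2 | ⟨h2, hz⟩
        · have e := c.cocycle x₀ x y z
          rw [h, h', h2] at e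
          generalize c.c x y z = v at *
          revert v; decide
        · subst h2
          exact h'
      · subst h; exact h'
    · subst h'
      rcases h with h | ⟨h, hy⟩
      · rw [(c.eq_zero_iff y x y).2 (by simp)] at h
        exact absurd h (by decide)
      · exact absurd rfl hy
  have fwd' : ∀ x y z, (c.Prec x₀ x y ∧ c.Prec x₀ y z ∨
    c.Prec x₀ y z ∧ c.Prec x₀ z x ∨ c.Prec x₀ z x ∧ c.Prec x₀ x y) → c.c x y z = 1 := by
    rintro x y z (h | h | h)
    · exact fwd _ _ _ h
    · rw [← c.rotate]; exact fwd _ _ _ h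
    · rw [← c.rotate, ← c.rotate]; exact fwd _ _ _ h
  refine ⟨fun h => ?_, fwd' x y z⟩
  have hxy : x ≠ y := by
    rintro rfl; rw [(c.eq_zero_iff x x z).2 (by simp)] at h; exact absurd h (by decide)
  have hyz : y ≠ z := by
    rintro rfl; rw [(c.eq_zero_iff x y y).2 (by simp)] at h; exact absurd h (by decide)
  have hxz : x ≠ z := by
    rintro rfl; rw [(c.eq_zero_iff x y x).2 (by simp)] at h; exact absurd h (by decide)
  -- If no rotation of `x, y, z` is increasing, totality makes a rotation of `y, x, z` increasing.
  -- That would force `c y x z = 1`, whereas `swap` gives `-1`.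
  by_contra hn
  have h' := fwd' y x z
  rw [c.swap, h] at h'
  have := Prec.total (c := c) (x₀ := x₀) hxy
  have := Prec.total (c := c) (x₀ := x₀) hyz
  have := Prec.total (c := c) (x₀ := x₀) hxz
  have t1 := @Prec.trans X c x₀ x y z
  have : ¬ (-1 : SignType) = 1 := by decide
  tauto

lemma c_eq_neg_one_iff (x y z : X) : c.c x y z = -1 ↔ c.Prec x₀ z y ∧ c.Prec x₀ y x ∨
    c.Prec x₀ y x ∧ c.Prec x₀ x z ∨ c.Prec x₀ x z ∧ c.Prec x₀ z y := by
  rw [← c_eq_one_iff, ← c.rotate, ← c.rotate, c.swap, c.rotate, c.rotate]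
  generalize c.c z y x = u
  revert u; decide

end CyclicOrder

/-! ### Left endpoints -/

section LeftEndpoint

open Classical in
/-- The total length of the intervals preceding that of `x`. -/
noncomputable def leftPos {X : Type*} (c : CyclicOrder X) (x₀ : X) (l : X → ℝ) (x : X) : ℝ :=
  ∑' y, if c.Prec x₀ y x then l y else 0

variable {X : Type*} {c : CyclicOrder X} {x₀ : X} {l : X → ℝ}

lemma summable_ite (hl : ∀ x, 0 < l x) (hs : Summable l) (P : X → Prop) [DecidablePred P] :
    Summable (fun y => if P y then l y else 0) := by
  refine Summable.of_nonneg_of_le (fun y => ?_) (fun y => ?_) hs <;> split_ifs <;>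
    simp [(hl y).le]

lemma leftPos_nonneg (hl : ∀ x, 0 < l x) (x : X) : 0 ≤ leftPos c x₀ l x :=
  tsum_nonneg fun y => by split_ifs <;> simp [(hl y).le]

/-- All predecessors of `x`, and `x` itself, are predecessors of `y`; this makes the intervals
disjoint and ordered. -/
lemma leftPos_add_le (hl : ∀ x, 0 < l x) (hs : Summable l) {x y : X} (h : c.Prec x₀ x y) :
    leftPos c x₀ l x + l x ≤ leftPos c x₀ l y := by
  classical
  unfold leftPos
  rw [← tsum_ite_eq x (fun y => l y), ← (summable_ite hl hs _).tsum_add (summable_ite hl hs _)]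
  refine Summable.tsum_le_tsum (fun z => ?_) ((summable_ite hl hs _).add (summable_ite hl hs _))
    (summable_ite hl hs _)
  by_cases hz : z = x
  · subst hz
    simp [h, CyclicOrder.Prec.irrefl]
  · by_cases hzx : c.Prec x₀ z x
    · simp [hz, hzx, hzx.trans h]
    · simp only [hz, hzx, if_false, add_zero]
      split_ifs <;> simp [(hl z).le]

lemma leftPos_add_le_one (hl : ∀ x, 0 < l x) (hs : HasSum l 1) (x : X) :
    leftPos c x₀ l x + l x ≤ 1 := by
  classical
  have hs' := hs.summable
  unfold leftPos
  rw [← tsum_ite_eq x (fun y => l y), ← (summable_ite hl hs' _).tsum_add (summable_ite hl hs' _),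
    ← hs.tsum_eq]
  refine Summable.tsum_le_tsum (fun z => ?_) ((summable_ite hl hs' _).add (summable_ite hl hs' _))
    hs'
  by_cases hz : z = x
  · subst hz
    simp [CyclicOrder.Prec.irrefl]
  · simp only [hz, if_false, add_zero]
    split_ifs <;> simp [(hl z).le]

lemma leftPos_lt_iff (hl : ∀ x, 0 < l x) (hs : Summable l) {x y : X} :
    leftPos c x₀ l x < leftPos c x₀ l y ↔ c.Prec x₀ x y := by
  constructor
  · intro h
    by_contra hn
    by_cases hxy : x = y
    · subst hxy; exact lt_irrefl _ h
    · have := leftPos_add_le hl hs ((CyclicOrder.Prec.total hxy).resolve_left hn)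
      linarith [hl y]
  · intro h
    linarith [leftPos_add_le hl hs h, hl x]

lemma rightPos_lt_iff (hl : ∀ x, 0 < l x) (hs : Summable l) {x y : X} :
    leftPos c x₀ l x + l x < leftPos c x₀ l y + l y ↔ c.Prec x₀ x y := by
  constructor
  · intro h
    by_contra hn
    by_cases hxy : x = y
    · subst hxy; exact lt_irrefl _ h
    · have := leftPos_add_le hl hs ((CyclicOrder.Prec.total hxy).resolve_left hn)
      linarith [hl x]
  · intro h
    linarith [leftPos_add_le hl hs h, hl y]

lemma leftPos_preserving (hl : ∀ x, 0 < l x) (hs : HasSum l 1) :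
    CyclicOrderPreserving c circleOrder (fun x => (leftPos c x₀ l x : UnitAddCircle)) := by
  refine circleOrder_preserving c _ (fun x y => ?_) (fun x y z => ?_) (fun x y z => ?_)
  · have := leftPos_add_le_one (c := c) (x₀ := x₀) hl hs
    rw [abs_lt]
    constructor <;> linarith [this x, this y, hl x, hl y,
      leftPos_nonneg (c := c) (x₀ := x₀) hl x, leftPos_nonneg (c := c) (x₀ := x₀) hl y]
  · simp only [leftPos_lt_iff hl hs.summable]; exact CyclicOrder.c_eq_one_iff x y z
  · simp only [leftPos_lt_iff hl hs.summable]; exact CyclicOrder.c_eq_neg_one_iff x y z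

lemma rightPos_preserving (hl : ∀ x, 0 < l x) (hs : HasSum l 1) :
    CyclicOrderPreserving c circleOrder
      (fun x => ((leftPos c x₀ l x + l x : ℝ) : UnitAddCircle)) := by
  refine circleOrder_preserving c _ (fun x y => ?_) (fun x y z => ?_) (fun x y z => ?_)
  · have := leftPos_add_le_one (c := c) (x₀ := x₀) hl hs
    rw [abs_lt]
    constructor <;> linarith [this x, this y, hl x, hl y,
      leftPos_nonneg (c := c) (x₀ := x₀) hl x, leftPos_nonneg (c := c) (x₀ := x₀) hl y]
  · simp only [rightPos_lt_iff hl hs.summable]; exact CyclicOrder.c_eq_one_iff x y z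
  · simp only [rightPos_lt_iff hl hs.summable]; exact CyclicOrder.c_eq_neg_one_iff x y z

/-- A cyclic-order-preserving permutation rotates the sums of lengths. -/
lemma coe_leftPos_equiv (hl : ∀ x, 0 < l x) (hs : HasSum l 1) (e : X ≃ X)
    (he : CyclicOrderPreserving c c e) (x : X) :
    ((leftPos c x₀ l (e x₀) + leftPos c x₀ (l ∘ e) x : ℝ) : UnitAddCircle)
      = (leftPos c x₀ l (e x) : UnitAddCircle) := by
  classical
  have hs' := hs.summable
  have e1 : leftPos c x₀ (l ∘ e) x = ∑' z, if c.Prec x₀ (e.symm z) x then l z else 0 := by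
    unfold leftPos
    rw [← e.symm.tsum_eq]
    simp
  have e2 : ∀ z, c.Prec x₀ (e.symm z) x ↔ c.c (e x₀) z (e x) = 1 ∨ (z = e x₀ ∧ e x ≠ e x₀) := by
    intro z
    have := he x₀ (e.symm z) x
    simp only [Equiv.apply_symm_apply] at this
    rw [this, CyclicOrder.Prec, Equiv.symm_apply_eq, e.injective.ne_iff]
  simp only [e2] at e1
  generalize e x₀ = p at *
  generalize e x = q at *
  -- With `p = e x₀` and `q = e x`, going from the base point to `q` is going to `p` and then along
  -- the cyclic arc from `p` to `q`. When `q` precedes `p` this passes the base point and adds a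
  -- full turn. The identity holds term by term in `z`; after summation the correction is 0 or 1 and
  -- vanishes in the circle.
  have e3 : ∀ z, ((if c.Prec x₀ z q then l z else 0) + (if c.Prec x₀ q p then l z else 0))
      = ((if c.Prec x₀ z p then l z else 0) +
        if c.c p z q = 1 ∨ (z = p ∧ q ≠ p) then l z else 0) := by
    intro z
    simp only [CyclicOrder.c_eq_one_iff (x₀ := x₀)]
    have i1 := CyclicOrder.Prec.irrefl (c := c) (x₀ := x₀)
    by_cases hpq : p = q
    · subst hpq
      have := @CyclicOrder.Prec.asymm X c x₀ p z
      have := i1 p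
      by_cases h1 : c.Prec x₀ z p <;> by_cases h2 : c.Prec x₀ p z <;> simp_all
    have a1 := @CyclicOrder.Prec.asymm X c x₀ p q
    have t1 := @CyclicOrder.Prec.total X c x₀ p q hpq
    by_cases hzp : z = p
    · subst hzp
      have := i1 z
      by_cases h1 : c.Prec x₀ z q <;> by_cases h2 : c.Prec x₀ q z <;> simp_all [Ne.symm]
    by_cases hzq : z = q
    · subst hzq
      have := i1 z
      by_cases h1 : c.Prec x₀ z p <;> by_cases h2 : c.Prec x₀ p z <;> simp_all
    have a2 := @CyclicOrder.Prec.asymm X c x₀ z q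
    have t2 := @CyclicOrder.Prec.total X c x₀ z q hzq
    have a3 := @CyclicOrder.Prec.asymm X c x₀ z p
    have t3 := @CyclicOrder.Prec.total X c x₀ z p hzp
    have r1 := @CyclicOrder.Prec.trans X c x₀ p q z
    have r2 := @CyclicOrder.Prec.trans X c x₀ p z q
    have r3 := @CyclicOrder.Prec.trans X c x₀ q p z
    have r4 := @CyclicOrder.Prec.trans X c x₀ q z p
    have r5 := @CyclicOrder.Prec.trans X c x₀ z p q
    have r6 := @CyclicOrder.Prec.trans X c x₀ z q p
    by_cases h1 : c.Prec x₀ z q <;> by_cases h2 : c.Prec x₀ q p <;>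
      by_cases h3 : c.Prec x₀ z p <;> simp_all
  have e4 := tsum_congr (L := .unconditional X) e3
  rw [(summable_ite hl hs' _).tsum_add (summable_ite hl hs' _),
    (summable_ite hl hs' _).tsum_add (summable_ite hl hs' _), ← e1] at e4
  change leftPos c x₀ l q + _ = leftPos c x₀ l p + _ at e4
  rw [← e4]
  by_cases h : c.Prec x₀ q p
  · simp [h, hs.tsum_eq]
  · simp [h]

end LeftEndpoint

/-! ### An equivariant family of interval diffeomorphisms -/

section Yoccoz

open Real

/-- The derivative of `yoccozMap a b`. -/
noncomputable def yoccozDeriv (a b s : ℝ) : ℝ :=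
  1 / (1 + ((a / b) ^ 2 - 1) * sin (π * s / a) ^ 2)

/-- Yoccoz's equivariant family of diffeomorphisms from `(0, a)` to `(0, b)`. -/
noncomputable def yoccozMap (a b s : ℝ) : ℝ :=
  b / π * (arctan (b / a * tan (π * s / a - π / 2)) + π / 2)

variable {a b : ℝ}

/-- The tangent conjugates `yoccozMap a b` to multiplication by `b / a` on the line, and these
factors multiply. -/
lemma yoccozMap_comp (hb : 0 < b) (c s : ℝ) :
    yoccozMap b c (yoccozMap a b s) = yoccozMap a c s := by
  unfold yoccozMap
  have h : π * (b / π * (arctan (b / a * tan (π * s / a - π / 2)) + π / 2)) / b - π / 2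
      = arctan (b / a * tan (π * s / a - π / 2)) := by
    field_simp
    ring
  rw [h, tan_arctan, ← mul_assoc, div_mul_div_cancel₀ hb.ne']

lemma yoccoz_angle_mem (ha : 0 < a) {s : ℝ} (hs : s ∈ Set.Ioo 0 a) :
    π * s / a - π / 2 ∈ Set.Ioo (-(π / 2)) (π / 2) := by
  have h1 : 0 < π * s / a := div_pos (mul_pos pi_pos hs.1) ha
  have h2 : π * s / a < π := by
    rw [div_lt_iff₀ ha]; exact mul_lt_mul_of_pos_left hs.2 pi_pos
  constructor <;> linarith

lemma yoccozMap_self (ha : 0 < a) {s : ℝ} (hs : s ∈ Set.Ioo 0 a) : yoccozMap a a s = s := by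
  have h := yoccoz_angle_mem ha hs
  rw [yoccozMap, div_self ha.ne', one_mul, arctan_tan h.1 h.2]
  field_simp
  ring

lemma yoccozMap_mem (hb : 0 < b) (s : ℝ) : yoccozMap a b s ∈ Set.Ioo 0 b := by
  unfold yoccozMap
  have h1 := neg_pi_div_two_lt_arctan (b / a * tan (π * s / a - π / 2))
  have h2 := arctan_lt_pi_div_two (b / a * tan (π * s / a - π / 2))
  have hp := pi_pos
  constructor
  · apply mul_pos (by positivity); linarith
  · rw [div_mul_eq_mul_div, div_lt_iff₀ hp]
    apply mul_lt_mul_of_pos_left _ hb; linarith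

/-- The denominator is a convex combination of 1 and `(a / b) ^ 2`, with weight `sin ^ 2` on the
latter. -/
lemma yoccozDeriv_denom (s : ℝ) {m : ℝ} (hm1 : m ≤ 1) (hm : m ≤ (a / b) ^ 2) :
    m ≤ 1 + ((a / b) ^ 2 - 1) * sin (π * s / a) ^ 2 := by
  have h0 := sq_nonneg (sin (π * s / a))
  have h1 := sin_sq_le_one (π * s / a)
  nlinarith

lemma yoccozDeriv_denom_pos (ha : 0 < a) (hb : 0 < b) (s : ℝ) :
    0 < 1 + ((a / b) ^ 2 - 1) * sin (π * s / a) ^ 2 := by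
  refine lt_of_lt_of_le ?_ (yoccozDeriv_denom s (min_le_left 1 ((a / b) ^ 2)) (min_le_right _ _))
  have : 0 < (a / b) ^ 2 := by positivity
  exact lt_min one_pos this

lemma yoccozDeriv_pos (ha : 0 < a) (hb : 0 < b) (s : ℝ) : 0 < yoccozDeriv a b s :=
  one_div_pos.2 (yoccozDeriv_denom_pos ha hb s)

lemma continuous_yoccozDeriv (ha : 0 < a) (hb : 0 < b) : Continuous (yoccozDeriv a b) := by
  unfold yoccozDeriv
  exact Continuous.div continuous_const (by fun_prop) fun s => (yoccozDeriv_denom_pos ha hb s).ne'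

lemma yoccozDeriv_zero : yoccozDeriv a b 0 = 1 := by simp [yoccozDeriv]

lemma yoccozDeriv_end (ha : 0 < a) : yoccozDeriv a b a = 1 := by
  simp [yoccozDeriv, mul_div_assoc, div_self ha.ne']

lemma hasDerivAt_yoccozMap (ha : 0 < a) (hb : 0 < b) {s : ℝ} (hs : s ∈ Set.Ioo 0 a) :
    HasDerivAt (yoccozMap a b) (yoccozDeriv a b s) s := by
  have hc := (cos_pos_of_mem_Ioo (yoccoz_angle_mem ha hs)).ne'
  have h1 : HasDerivAt (fun s => π * s / a - π / 2) (π / a) s := by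
    simpa using (((hasDerivAt_id s).const_mul π).div_const a).sub_const (π / 2)
  have h2 := (((((hasDerivAt_tan hc).comp s h1).const_mul (b / a)).arctan).add_const (π / 2)).const_mul (b / π)
  refine h2.congr_deriv ?_
  have e1 : cos (π * s / a - π / 2) = sin (π * s / a) := cos_sub_pi_div_two _
  have e2 : sin (π * s / a - π / 2) = -cos (π * s / a) := sin_sub_pi_div_two _
  have hd := (yoccozDeriv_denom_pos ha hb s).ne'
  rw [e1] at hc
  have hd' := yoccozDeriv_denom_pos ha hb s
  have hsc := sin_sq_add_cos_sq (π * s / a)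
  rw [yoccozDeriv, Function.comp_apply, tan_eq_sin_div_cos, e1, e2]
  generalize sin (π * s / a) = S at *
  generalize cos (π * s / a) = C at *
  have hp := pi_pos.ne'
  have h3 : 1 + ((a / b) ^ 2 - 1) * S ^ 2 = C ^ 2 + (a / b) ^ 2 * S ^ 2 := by linarith
  rw [h3] at hd hd' ⊢
  have h4 : 1 + (b / a * (-C / S)) ^ 2 = (b / a) ^ 2 / S ^ 2 * (C ^ 2 + (a / b) ^ 2 * S ^ 2) := by
    field_simp
    ring
  rw [h4]
  field_simp

/-- Since `tan` is 0 at `±π / 2` by convention, the formula for `yoccozMap` gives `b / 2` at both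
ends of `[0, a]`. The true boundary values exist only as limits, and the integrals below use them in
that form. -/
lemma tendsto_yoccozMap_left (ha : 0 < a) (hb : 0 < b) :
    Tendsto (yoccozMap a b) (𝓝[>] 0) (𝓝 0) := by
  have h1 : Tendsto (fun s => π * s / a - π / 2) (𝓝[>] 0) (𝓝[>] (-(π / 2))) := by
    apply tendsto_nhdsWithin_of_tendsto_nhds_of_eventually_within
    · have : Continuous (fun s : ℝ => π * s / a - π / 2) := by fun_prop
      have h := this.tendsto 0
      simp only [mul_zero, zero_div, zero_sub] at h
      exact h.mono_left nhdsWithin_le_nhds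
    · filter_upwards [Ioo_mem_nhdsGT ha] with s hs
      exact (yoccoz_angle_mem ha hs).1
  have h2 := (tendsto_tan_neg_pi_div_two.comp h1).const_mul_atBot (div_pos hb ha)
  have h3 := ((tendsto_arctan_atBot.mono_right nhdsWithin_le_nhds).comp h2).add_const (π / 2)
  have h4 := h3.const_mul (b / π)
  rw [neg_add_cancel, mul_zero] at h4
  exact h4

lemma tendsto_yoccozMap_right (ha : 0 < a) (hb : 0 < b) :
    Tendsto (yoccozMap a b) (𝓝[<] a) (𝓝 b) := by
  have h1 : Tendsto (fun s => π * s / a - π / 2) (𝓝[<] a) (𝓝[<] (π / 2)) := by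
    apply tendsto_nhdsWithin_of_tendsto_nhds_of_eventually_within
    · have : Continuous (fun s : ℝ => π * s / a - π / 2) := by fun_prop
      have h := this.tendsto a
      have e : π * a / a - π / 2 = π / 2 := by field_simp; ring
      rw [e] at h
      exact h.mono_left nhdsWithin_le_nhds
    · filter_upwards [Ioo_mem_nhdsLT ha] with s hs
      exact (yoccoz_angle_mem ha hs).2
  have h2 := (tendsto_tan_pi_div_two.comp h1).const_mul_atTop (div_pos hb ha)
  have h3 := ((tendsto_arctan_atTop.mono_right nhdsWithin_le_nhds).comp h2).add_const (π / 2)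
  have h4 := h3.const_mul (b / π)
  have e : b / π * (π / 2 + π / 2) = b := by
    have := pi_pos.ne'
    field_simp; ring
  rw [e] at h4
  exact h4

lemma integral_yoccozDeriv (ha : 0 < a) (hb : 0 < b) {s : ℝ} (hs : s ∈ Set.Ioo 0 a) :
    ∫ t in (0 : ℝ)..s, yoccozDeriv a b t = yoccozMap a b s := by
  rw [intervalIntegral.integral_eq_sub_of_hasDerivAt_of_tendsto hs.1
    (fun t ht => hasDerivAt_yoccozMap ha hb ⟨ht.1, ht.2.trans hs.2⟩)
    ((continuous_yoccozDeriv ha hb).intervalIntegrable _ _) (tendsto_yoccozMap_left ha hb)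
    ((hasDerivAt_yoccozMap ha hb hs).continuousAt.tendsto.mono_left nhdsWithin_le_nhds), sub_zero]

lemma integral_yoccozDeriv_total (ha : 0 < a) (hb : 0 < b) :
    ∫ t in (0 : ℝ)..a, yoccozDeriv a b t = b := by
  rw [intervalIntegral.integral_eq_sub_of_hasDerivAt_of_tendsto ha
    (fun t ht => hasDerivAt_yoccozMap ha hb ht)
    ((continuous_yoccozDeriv ha hb).intervalIntegrable _ _) (tendsto_yoccozMap_left ha hb)
    (tendsto_yoccozMap_right ha hb), sub_zero]

lemma abs_yoccozDeriv_sub_one_le {m : ℝ} (hm0 : 0 < m) (hm1 : m ≤ 1)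
    (hm : m ≤ (a / b) ^ 2) (s : ℝ) :
    |yoccozDeriv a b s - 1| ≤ |(a / b) ^ 2 - 1| / m := by
  have hd := yoccozDeriv_denom s hm1 hm
  have hd0 := hm0.trans_le hd
  have h1 := sin_sq_le_one (π * s / a)
  have e : yoccozDeriv a b s - 1 = -(((a / b) ^ 2 - 1) * sin (π * s / a) ^ 2) /
      (1 + ((a / b) ^ 2 - 1) * sin (π * s / a) ^ 2) := by
    rw [yoccozDeriv, eq_div_iff hd0.ne', sub_mul, one_div, inv_mul_cancel₀ hd0.ne']
    ring
  rw [e, abs_div, abs_neg, abs_mul, abs_of_pos hd0, abs_of_nonneg (sq_nonneg (sin _))]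
  refine div_le_div₀ (abs_nonneg _) ?_ hm0 hd
  exact mul_le_of_le_one_right (abs_nonneg _) h1

lemma abs_sin_sq_sub_le (x y : ℝ) : |sin x ^ 2 - sin y ^ 2| ≤ |x - y| := by
  have e : sin x ^ 2 - sin y ^ 2 = sin (x + y) * sin (x - y) := by
    rw [sin_add, sin_sub]
    have hx := sin_sq_add_cos_sq x
    have hy := sin_sq_add_cos_sq y
    have hx' : cos x ^ 2 = 1 - sin x ^ 2 := by linarith
    have hy' : cos y ^ 2 = 1 - sin y ^ 2 := by linarith
    ring_nf
    rw [hx', hy']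
    ring
  rw [e, abs_mul]
  calc |sin (x + y)| * |sin (x - y)| ≤ 1 * |x - y| :=
        mul_le_mul (abs_sin_le_one _) abs_sin_le_abs (abs_nonneg _) zero_le_one
    _ = _ := one_mul _

/-- The factor `π / a` comes from the argument of the sine; it is later compensated by the smallness
of `(a / b) ^ 2 - 1`. -/
lemma abs_yoccozDeriv_sub_le (ha : 0 < a) {m : ℝ} (hm0 : 0 < m) (hm1 : m ≤ 1)
    (hm : m ≤ (a / b) ^ 2) (s t : ℝ) :
    |yoccozDeriv a b s - yoccozDeriv a b t|
      ≤ |(a / b) ^ 2 - 1| / m ^ 2 * (π / a) * |s - t| := by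
  have hd := yoccozDeriv_denom s hm1 hm
  have hd0 := hm0.trans_le hd
  have hd' := yoccozDeriv_denom t hm1 hm
  have hd0' := hm0.trans_le hd'
  have e : yoccozDeriv a b s - yoccozDeriv a b t =
      (((a / b) ^ 2 - 1) * (sin (π * t / a) ^ 2 - sin (π * s / a) ^ 2)) /
      ((1 + ((a / b) ^ 2 - 1) * sin (π * s / a) ^ 2) *
        (1 + ((a / b) ^ 2 - 1) * sin (π * t / a) ^ 2)) := by
    rw [yoccozDeriv, yoccozDeriv, div_sub_div _ _ hd0.ne' hd0'.ne']
    ring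
  have h2 : |sin (π * t / a) ^ 2 - sin (π * s / a) ^ 2| ≤ π / a * |s - t| := by
    refine (abs_sin_sq_sub_le _ _).trans_eq ?_
    rw [abs_sub_comm, ← sub_div, ← mul_sub, abs_div, abs_mul, abs_of_pos pi_pos, abs_of_pos ha]
    ring
  rw [e, abs_div, abs_mul, abs_of_pos (mul_pos hd0 hd0')]
  calc _ ≤ |(a / b) ^ 2 - 1| * (π / a * |s - t|) / (m ^ 2) := by
        refine div_le_div₀ ?_ ?_ (by positivity) ?_
        · have := pi_pos
          positivity
        · exact mul_le_mul_of_nonneg_left h2 (abs_nonneg _)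
        · rw [sq]; exact mul_le_mul hd hd' hm0.le hd0.le
    _ = _ := by ring

end Yoccoz

/-! ### A level function with slow growth -/

section Level

open scoped ENNReal

variable {G X : Type*} [Group G] [MulAction G X]

/-- `Reach K w n y` means that `y` is obtained from some `x` by a product of group elements with
`K x` plus the total weight of the factors at most `n`. -/
inductive Reach (K : X → ℕ) (w : G → ℕ) : ℕ → X → Prop
  | base (x : X) (n : ℕ) : K x ≤ n → Reach K w n x
  | step (g : G) (x : X) (n : ℕ) : Reach K w n x → Reach K w (n + w g) (g • x)

lemma finite_pow_smul (S : Finset G) (x : X) (n : ℕ) :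
    ((fun g : G => g • x) '' ((S : Set G) ^ n)).Finite := by
  classical
  rw [← Finset.coe_pow]
  exact (Finset.finite_toSet _).image _

/-- A function on a countable `G`-set that every group element changes by a bounded amount and
whose fibres are small with respect to `F`. -/
theorem exists_level [Countable G] [Countable X] [Nonempty X] (F : ℕ → ℝ) (hF : ∀ n, 0 < F n)
    (hFsum : ∀ (S : Finset G) (x : X), Summable fun n : ℕ => (orbitGrowth S x n : ℝ) / F n) :
    ∃ ν : X → ℕ, (∀ g : G, ∃ w, ∀ x, ν (g • x) ≤ ν x + w) ∧
      Summable fun x => 1 / F (ν x) := by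
  classical
  obtain ⟨e, he⟩ := exists_surjective_nat G
  obtain ⟨p, hp⟩ := exists_surjective_nat X
  choose ie hie using he
  choose ip hip using hp
  -- An increasing exhaustion of `G` by finite sets. Containing 1 makes the powers of each set
  -- increase with the exponent.
  let S : ℕ → Finset G := fun m => insert 1 ((Finset.range (m + 1)).image e)
  have hS1 : ∀ m, (1 : G) ∈ (S m : Set G) := fun m => by simp [S]
  have hSmem : ∀ g m, ie g ≤ m → g ∈ (S m : Set G) := by
    intro g m h
    simp only [S, Finset.coe_insert, Finset.coe_image, Set.mem_insert_iff, Set.mem_image]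
    right
    exact ⟨ie g, by simpa using Nat.lt_succ_of_le h, hie g⟩
  have hSmono : ∀ m m', m ≤ m' → (S m : Set G) ⊆ S m' := by
    intro m m' h
    simp only [S, Finset.coe_insert, Finset.coe_image]
    refine Set.insert_subset_insert (Set.image_mono ?_)
    simpa using Nat.succ_le_succ h
  let u : ℕ → ℕ → ℝ := fun m n => ∑ i ∈ Finset.range (m + 1), (orbitGrowth (S m) (p i) n : ℝ) / F n
  have hu0 : ∀ m n, 0 ≤ u m n := fun m n =>
    Finset.sum_nonneg fun i _ => div_nonneg (Nat.cast_nonneg _) (hF n).le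
  have hu : ∀ m, Summable (u m) := fun m => summable_sum fun i _ => hFsum (S m) (p i)
  -- Beyond the threshold `N m`, the orbits of the first points under `S m` contribute less than `2
  -- ^ (-m)`.
  have hN : ∀ m, ∃ N, ∑' k, u m (k + N) < (1 / 2 : ℝ) ^ m := fun m =>
    ((tendsto_sum_nat_add (u m)).eventually (gt_mem_nhds (by positivity))).exists
  choose N hN using hN
  let K : X → ℕ := fun x => N (ip x) + 1
  -- Using `g` costs enough to pass the threshold of the set `S (ie g)` that contains it; the extra
  -- 1 pays for the additional factor in the product.
  let w : G → ℕ := fun g => N (ie g) + 1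
  have key : ∀ n y, Reach K w n y → ∃ m, N m ≤ n ∧ ∃ i ∈ Finset.range (m + 1),
      y ∈ (fun g : G => g • p i) '' ((S m : Set G) ^ n) := by
    intro n y h
    induction h with
    | base x n hn =>
      refine ⟨ip x, by simp only [K] at hn; omega, ip x, by simp, 1, ?_, by simp [hip]⟩
      exact Set.one_mem_pow (hS1 _)
    | step g x n _ ih =>
      obtain ⟨m, hm, i, hi, h, hh, rfl⟩ := ih
      refine ⟨max m (ie g), ?_, i, ?_, g * h, ?_, by simp [mul_smul]⟩
      · rcases max_choice m (ie g) with h | h <;> rw [h] <;> simp only [w] <;> omega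
      · simp only [Finset.mem_range] at *
        have := le_max_left m (ie g); omega
      · have h1 : h ∈ (S (max m (ie g)) : Set G) ^ n :=
          Set.pow_subset_pow_left (hSmono _ _ (le_max_left _ _)) hh
        have h2 : g * h ∈ (S (max m (ie g)) : Set G) ^ (n + 1) := by
          rw [pow_succ']
          exact Set.mul_mem_mul (hSmem g _ (le_max_right _ _)) h1
        exact Set.pow_subset_pow_right (hS1 _) (by simp only [w]; omega) h2
  have hex : ∀ x, ∃ n, Reach K w n x := fun x => ⟨K x, .base x _ le_rfl⟩
  -- The level of a point is the least cost of reaching it, so acting by `g` raises it by at most `w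
  -- g`.
  refine ⟨fun x => Nat.find (hex x), fun g => ⟨w g, fun x => ?_⟩, ?_⟩
  · exact Nat.find_min' _ (.step g x _ (Nat.find_spec (hex x)))
  let ν : X → ℕ := fun x => Nat.find (hex x)
  change Summable fun x => 1 / F (ν x)
  -- A majorant that charges `y` with `1 / F n` for every `n = k + N m` at which it lies in one of
  -- the orbit pieces `S m ^ n • p i`. By `key`, the choice `n = ν y` occurs. Exchanging the sums
  -- counts the pieces and leaves the tails `< 2 ^ (-m)`.
  let a : ℕ → ℕ → X → ℝ≥0∞ := fun m k y => ∑ i ∈ Finset.range (m + 1),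
    if y ∈ (fun g : G => g • p i) '' ((S m : Set G) ^ (k + N m))
      then ENNReal.ofReal (1 / F (k + N m)) else 0
  have h1 : ∀ y, ENNReal.ofReal (1 / F (ν y)) ≤ ∑' m, ∑' k, a m k y := by
    intro y
    obtain ⟨m, hm, i, hi, hy⟩ := key _ y (Nat.find_spec (hex y))
    change N m ≤ ν y at hm
    change y ∈ (fun g : G => g • p i) '' ((S m : Set G) ^ (ν y)) at hy
    obtain ⟨k, hk⟩ : ∃ k, ν y = k + N m := ⟨ν y - N m, by omega⟩
    refine le_trans ?_ (ENNReal.le_tsum m)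
    refine le_trans ?_ (ENNReal.le_tsum k)
    rw [hk] at hy ⊢
    refine le_trans ?_ (Finset.single_le_sum (f := fun i =>
      if y ∈ (fun g : G => g • p i) '' ((S m : Set G) ^ (k + N m))
      then ENNReal.ofReal (1 / F (k + N m)) else 0) (fun _ _ => zero_le) hi)
    simp only [if_pos hy]
    exact le_rfl
  have h2 : ∀ m k, ∑' y, a m k y = ENNReal.ofReal (u m (k + N m)) := by
    intro m k
    simp only [a, u]
    rw [Summable.tsum_finsetSum fun _ _ => ENNReal.summable, ENNReal.ofReal_sum_of_nonneg]
    swap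
    · intro i _; exact div_nonneg (Nat.cast_nonneg _) (hF _).le
    refine Finset.sum_congr rfl fun i _ => ?_
    have hfin := finite_pow_smul (S m) (p i) (k + N m)
    rw [tsum_eq_sum (s := hfin.toFinset) (fun y hy => if_neg (by simpa using hy))]
    rw [Finset.sum_congr rfl (fun y hy => if_pos ((Set.Finite.mem_toFinset hfin).1 hy)),
      Finset.sum_const, ← Set.ncard_eq_toFinset_card _ hfin, nsmul_eq_mul,
      ← ENNReal.ofReal_natCast, ← ENNReal.ofReal_mul (Nat.cast_nonneg _), mul_one_div]
    rfl
  have h3 : ∑' y, ENNReal.ofReal (1 / F (ν y)) ≠ ∞ := by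
    refine ne_top_of_le_ne_top ?_ (ENNReal.tsum_le_tsum h1)
    rw [ENNReal.tsum_comm]
    have h4 : ∀ m, ∑' y, ∑' k, a m k y ≤ ENNReal.ofReal ((1 / 2 : ℝ) ^ m) := by
      intro m
      rw [ENNReal.tsum_comm]
      simp only [h2]
      rw [← ENNReal.ofReal_tsum_of_nonneg (fun k => hu0 m _)
        ((summable_nat_add_iff (N m)).2 (hu m))]
      exact ENNReal.ofReal_le_ofReal (hN m).le
    refine ne_top_of_le_ne_top ?_ (ENNReal.tsum_le_tsum h4)
    rw [← ENNReal.ofReal_tsum_of_nonneg (fun k => by positivity) summable_geometric_two]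
    exact ENNReal.ofReal_ne_top
  have h5 := ENNReal.summable_toReal h3
  refine h5.congr fun x => ?_
  rw [ENNReal.toReal_ofReal (one_div_nonneg.2 (hF _).le)]

end Level

/-! ### Ratios of a slowly varying function -/

section Ratio

variable {F : ℕ → ℝ} {τ : ℝ → ℝ}

lemma ratio_le_pow (hF : ∀ n, 0 < F n) {M : ℝ} (hM : ∀ n, F (n + 1) / F n ≤ M) (hM0 : 0 ≤ M)
    (j n : ℕ) : F (n + j) ≤ M ^ j * F n := by
  induction j with
  | zero => simp
  | succ j ih =>
    have h := (div_le_iff₀ (hF _)).1 (hM (n + j))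
    calc F (n + (j + 1)) ≤ M * F (n + j) := h
      _ ≤ M * (M ^ j * F n) := mul_le_mul_of_nonneg_left ih hM0
      _ = _ := by ring

/-- Telescoping: each further step multiplies by a bounded ratio, and its defect, measured at `1 / F
(n + j) ≤ 1 / F n`, is dominated through the monotonicity of `τ`. -/
lemma exists_ratio_sub_one_le (hF : ∀ n, 0 < F n) (hmono : Monotone F) {M : ℝ}
    (hM : ∀ n, F (n + 1) / F n ≤ M) (hM0 : 0 ≤ M)
    (hτ0 : ∀ t, 0 < t → 0 < τ t) (hτ : ∀ s t, 0 < s → s ≤ t → τ s ≤ τ t)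
    {C : ℝ} (hC0 : 0 ≤ C) (hC : ∀ n, F (n + 1) / F n - 1 ≤ C * τ (1 / F n)) (j : ℕ) :
    ∃ D, 0 ≤ D ∧ ∀ n, F (n + j) / F n - 1 ≤ D * τ (1 / F n) := by
  induction j with
  | zero =>
    refine ⟨0, le_rfl, fun n => ?_⟩
    simp [div_self (hF n).ne']
  | succ j ih =>
    obtain ⟨D, hD0, hD⟩ := ih
    refine ⟨M ^ j * C + D, by positivity, fun n => ?_⟩
    have h1 := ratio_le_pow hF hM hM0 j n
    rw [← div_le_iff₀ (hF n)] at h1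
    have h2 : τ (1 / F (n + j)) ≤ τ (1 / F n) :=
      hτ _ _ (one_div_pos.2 (hF _)) (one_div_le_one_div_of_le (hF n) (hmono (Nat.le_add_right n j)))
    have h3 : F (n + (j + 1)) / F n - 1
        = F (n + j) / F n * (F (n + j + 1) / F (n + j) - 1) + (F (n + j) / F n - 1) := by
      have := (hF n).ne'
      have := (hF (n + j)).ne'
      rw [← add_assoc]
      field_simp
      ring
    have h4 : 0 ≤ τ (1 / F n) := (hτ0 _ (one_div_pos.2 (hF _))).le
    calc F (n + (j + 1)) / F n - 1
        ≤ M ^ j * (C * τ (1 / F n)) + D * τ (1 / F n) := by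
          rw [h3]
          refine add_le_add ?_ (hD n)
          refine mul_le_mul h1 ((hC _).trans (mul_le_mul_of_nonneg_left h2 hC0)) ?_ (by positivity)
          rw [sub_nonneg, one_le_div (hF _)]
          exact hmono (Nat.le_succ _)
      _ = _ := by ring

/-- The upper bound is monotonicity of `F`. The lower one inverts the ratio, through `r⁻¹ ≥ 2 - r`.
-/
lemma abs_ratio_sub_one_le (hF : ∀ n, 0 < F n) (hmono : Monotone F) {w n m : ℕ}
    (hm : m ≤ n + w) (hn : n ≤ m + w) {B : ℝ}
    (h1 : F (n + w) / F n - 1 ≤ B) (h2 : F (m + w) / F m - 1 ≤ B) : |F m / F n - 1| ≤ B := by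
  rw [abs_le]
  constructor
  · have h3 : F n / F m ≤ F (m + w) / F m := div_le_div_of_nonneg_right (hmono hn) (hF m).le
    have h4 : 2 - F n / F m ≤ F m / F n := by
      rw [← inv_div (F n) (F m)]
      have : 0 < F n / F m := div_pos (hF n) (hF m)
      generalize F n / F m = r at *
      have h5 : r⁻¹ - (2 - r) = (r - 1) ^ 2 / r := by field_simp; ring
      have h6 : 0 ≤ (r - 1) ^ 2 / r := by positivity
      linarith
    linarith
  · have h3 : F m / F n ≤ F (n + w) / F n := div_le_div_of_nonneg_right (hmono hm) (hF n).le
    linarith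

lemma tendsto_ratio (hF : ∀ n, 0 < F n)
    (hlim : Tendsto (fun n => F (n + 1) / F n) atTop (𝓝 1)) (w : ℕ) :
    Tendsto (fun n => F (n + w) / F n) atTop (𝓝 1) := by
  induction w with
  | zero => simp [div_self (hF _).ne']
  | succ w ih =>
    have h := ((tendsto_add_atTop_iff_nat w).2 hlim).mul ih
    rw [one_mul] at h
    refine h.congr fun n => ?_
    rw [div_mul_div_cancel₀ (hF _).ne', add_assoc]

/-- Lengths on a countable `G`-set with total sum `1` and with slowly varying ratios along the
orbits. -/
theorem exists_lengths {G X : Type*} [Group G] [Countable G] [Countable X] [Nonempty X]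
    [MulAction G X] (hF : ∀ n, 0 < F n) (hmono : Monotone F)
    (hlim : Tendsto (fun n => F (n + 1) / F n) atTop (𝓝 1))
    (hFsum : ∀ (S : Finset G) (x : X), Summable fun n : ℕ => (orbitGrowth S x n : ℝ) / F n)
    (hτ0 : ∀ t, 0 < t → 0 < τ t) (hτ : ∀ s t, 0 < s → s ≤ t → τ s ≤ τ t)
    (hτ' : ∀ s t, 0 < s → s ≤ t → τ t * s ≤ τ s * t)
    {C : ℝ} (hC0 : 0 ≤ C) (hC : ∀ n, F (n + 1) / F n - 1 ≤ C * τ (1 / F n))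
    (S : Finset G) {δ : ℝ} (hδ : 0 < δ) :
    ∃ l : X → ℝ, (∀ x, 0 < l x) ∧ HasSum l 1 ∧
      (∀ g : G, ∃ B, 0 ≤ B ∧ ∀ x, |l x / l (g • x) - 1| ≤ B * τ (l x)) ∧
      (∀ g : G, ∃ m, 0 < m ∧ ∀ x, m ≤ l x / l (g • x)) ∧
      ∀ s ∈ S, ∀ x, |l x / l (s • x) - 1| ≤ δ := by
  obtain ⟨ν, hν, hsum⟩ := exists_level F hF hFsum
  have hν' : ∀ g : G, ∃ w, ∀ x, ν (g • x) ≤ ν x + w ∧ ν x ≤ ν (g • x) + w := by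
    intro g
    obtain ⟨w₁, h₁⟩ := hν g
    obtain ⟨w₂, h₂⟩ := hν g⁻¹
    refine ⟨max w₁ w₂, fun x => ⟨(h₁ x).trans (by gcongr; exact le_max_left _ _), ?_⟩⟩
    have := h₂ (g • x)
    rw [inv_smul_smul] at this
    exact this.trans (by gcongr; exact le_max_right _ _)
  choose w hw using hν'
  obtain ⟨M, hM⟩ : ∃ M, ∀ n, F (n + 1) / F n ≤ M := by
    obtain ⟨M, hM⟩ := hlim.bddAbove_range
    exact ⟨M, fun n => hM ⟨n, rfl⟩⟩
  have hM1 : 1 ≤ M := ((one_le_div (hF 0)).2 (hmono (Nat.le_succ 0))).trans (hM 0)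
  have hM0 : 0 < M := by linarith
  -- Shifting all levels by `k` discards the initial range where ratios along `S` may exceed `1 +
  -- δ`, and it keeps the sum finite.
  obtain ⟨k, hk⟩ : ∃ k, ∀ s ∈ S, ∀ n, k ≤ n → F (n + w s) / F n - 1 ≤ δ := by
    have : ∀ᶠ n in atTop, ∀ s ∈ S, F (n + w s) / F n - 1 ≤ δ := by
      rw [Filter.eventually_all_finset]
      intro s _
      have h := (tendsto_ratio hF hlim (w s)).sub_const 1
      rw [sub_self] at h
      exact h.eventually (ge_mem_nhds hδ)
    obtain ⟨k, hk⟩ := eventually_atTop.1 this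
    exact ⟨k, fun s hs n hn => hk n hn s hs⟩
  have hsum' : Summable fun x => 1 / F (ν x + k) :=
    Summable.of_nonneg_of_le (fun x => one_div_nonneg.2 (hF _).le)
      (fun x => one_div_le_one_div_of_le (hF _) (hmono (Nat.le_add_right _ _))) hsum
  set Z := ∑' x, 1 / F (ν x + k) with hZ
  have hZ0 : 0 < Z := hsum'.tsum_pos (fun x => one_div_nonneg.2 (hF _).le)
    (Classical.arbitrary X) (one_div_pos.2 (hF _))
  have hratio : ∀ (g : G) x, (1 / F (ν x + k) / Z) / (1 / F (ν (g • x) + k) / Z)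
      = F (ν (g • x) + k) / F (ν x + k) := by
    intro g x
    have := (hF (ν x + k)).ne'
    have := (hF (ν (g • x) + k)).ne'
    field_simp
  -- Normalizing the total length changes `τ` by a bounded factor: monotonicity of `τ` handles `Z ≤
  -- 1`, that of `τ t / t` handles `Z ≥ 1`.
  have hτZ : ∀ t, 0 < t → τ t ≤ max 1 Z * τ (t / Z) := by
    intro t ht
    have hpos := hτ0 (t / Z) (div_pos ht hZ0)
    rcases le_total Z 1 with h | h
    · rw [max_eq_left h, one_mul]
      exact hτ _ _ ht ((le_div_iff₀ hZ0).2 (mul_le_of_le_one_right ht.le h))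
    · rw [max_eq_right h]
      have := hτ' (t / Z) t (div_pos ht hZ0) (div_le_self ht.le h)
      rw [mul_div_assoc', div_le_iff₀ hZ0] at this
      nlinarith
  refine ⟨fun x => 1 / F (ν x + k) / Z, fun x => div_pos (one_div_pos.2 (hF _)) hZ0, ?_,
    fun g => ?_, fun g => ?_, fun s hs x => ?_⟩
  · have := hsum'.hasSum.div_const Z
    rwa [← hZ, div_self hZ0.ne'] at this
  · obtain ⟨D, hD0, hD⟩ := exists_ratio_sub_one_le hF hmono hM hM0.le hτ0 hτ hC0 hC (w g)
    refine ⟨D * M ^ w g * max 1 Z, by positivity, fun x => ?_⟩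
    simp only [hratio]
    have e1 := (hw g x).1
    have e2 := (hw g x).2
    have hMw : 1 ≤ M ^ w g := one_le_pow₀ hM1
    have hZ' := hτZ (1 / F (ν x + k)) (one_div_pos.2 (hF _))
    have hle : D * M ^ w g * τ (1 / F (ν x + k))
        ≤ D * M ^ w g * max 1 Z * τ (1 / F (ν x + k) / Z) := by
      rw [mul_assoc (D * M ^ w g)]
      exact mul_le_mul_of_nonneg_left hZ' (by positivity)
    refine (abs_ratio_sub_one_le hF hmono (w := w g) (by omega) (by omega) ?_ ?_).trans hle
    · refine (hD _).trans ?_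
      have := (hτ0 (1 / F (ν x + k)) (one_div_pos.2 (hF _))).le
      rw [mul_assoc]
      exact mul_le_mul_of_nonneg_left (le_mul_of_one_le_left this hMw) hD0
    · refine (hD _).trans ?_
      rw [mul_assoc]
      refine mul_le_mul_of_nonneg_left ?_ hD0
      -- This bound is based at the level of `g • x`. It is moved to the level of `x` using `τ (A *
      -- t) ≤ A * τ t` for `A = M ^ w g ≥ 1`.
      have hFle : F (ν x + k) ≤ M ^ w g * F (ν (g • x) + k) :=
        (hmono (by omega)).trans (ratio_le_pow hF hM hM0.le (w g) (ν (g • x) + k))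
      have hp : 0 < 1 / F (ν x + k) := one_div_pos.2 (hF _)
      have h1 : 1 / F (ν (g • x) + k) ≤ M ^ w g * (1 / F (ν x + k)) := by
        rw [mul_one_div, div_le_div_iff₀ (hF _) (hF _), one_mul]
        exact hFle
      refine (hτ _ _ (one_div_pos.2 (hF _)) h1).trans ?_
      have h2 := hτ' (1 / F (ν x + k)) (M ^ w g * (1 / F (ν x + k))) hp
        (le_mul_of_one_le_left hp.le hMw)
      rw [← mul_assoc] at h2
      have h3 := le_of_mul_le_mul_right h2 hp
      exact h3.trans_eq (mul_comm _ _)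
  · refine ⟨1 / M ^ w g, by positivity, fun x => ?_⟩
    simp only [hratio]
    have e2 := (hw g x).2
    have hFle : F (ν x + k) ≤ M ^ w g * F (ν (g • x) + k) :=
      (hmono (by omega)).trans (ratio_le_pow hF hM hM0.le (w g) (ν (g • x) + k))
    rw [div_le_div_iff₀ (by positivity) (hF _), one_mul, mul_comm]
    exact hFle
  · simp only [hratio]
    have e1 := (hw s x).1
    have e2 := (hw s x).2
    exact abs_ratio_sub_one_le hF hmono (w := w s) (by omega) (by omega)
      (hk s hs _ (Nat.le_add_left _ _)) (hk s hs _ (Nat.le_add_left _ _))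

end Ratio

/-! ### Tilings of the circle by intervals and the associated circle maps -/

section Tiling

open MeasureTheory Set

/-- The intervals `(L x, L x + l x)` are disjoint, lie in `[0, 1]` and have total length `1`. -/
structure IsTiling {X : Type*} (L l : X → ℝ) : Prop where
  pos : ∀ x, 0 < l x
  nonneg : ∀ x, 0 ≤ L x
  le_one : ∀ x, L x + l x ≤ 1
  sep : ∀ x y, x ≠ y → L x + l x ≤ L y ∨ L y + l y ≤ L x
  hasSum : HasSum l 1

open Classical in
/-- The derivative of the circle map sending the intervals of lengths `l` to intervals of
lengths `l'` by `yoccozMap`. -/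
noncomputable def density {X : Type*} (L l l' : X → ℝ) (t : ℝ) : ℝ :=
  if h : ∃ x, Int.fract t ∈ Ioo (L x) (L x + l x) then
    yoccozDeriv (l h.choose) (l' h.choose) (Int.fract t - L h.choose) else 1

variable {X : Type*} {L l l' : X → ℝ}

namespace IsTiling

lemma fract_eq (h : IsTiling L l) {x : X} {n : ℤ} {t : ℝ}
    (ht : t - n ∈ Ioo (L x) (L x + l x)) : Int.fract t = t - n := by
  rw [Int.fract_eq_iff]
  refine ⟨(h.nonneg x).trans ht.1.le, ht.2.trans_le (h.le_one x), n, by ring⟩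

lemma unique (h : IsTiling L l) {x y : X} {t : ℝ} (hx : t ∈ Ioo (L x) (L x + l x))
    (hy : t ∈ Ioo (L y) (L y + l y)) : x = y := by
  by_contra hne
  rcases h.sep x y hne with h' | h' <;> linarith [hx.1, hx.2, hy.1, hy.2]

lemma density_of_mem (h : IsTiling L l) {x : X} {n : ℤ} {t : ℝ}
    (ht : t - n ∈ Ioo (L x) (L x + l x)) :
    density L l l' t = yoccozDeriv (l x) (l' x) (t - n - L x) := by
  have hf := h.fract_eq ht
  have hex : ∃ x, Int.fract t ∈ Ioo (L x) (L x + l x) := ⟨x, by rwa [hf]⟩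
  have hx : hex.choose = x := h.unique hex.choose_spec (by rwa [hf])
  rw [density, dif_pos hex, hx, hf]

lemma density_of_notMem {t : ℝ} (ht : ∀ x (n : ℤ), t - n ∉ Ioo (L x) (L x + l x)) :
    density L l l' t = 1 := by
  rw [density, dif_neg]
  rintro ⟨x, hx⟩
  exact ht x ⌊t⌋ hx

lemma density_add_one (t : ℝ) : density L l l' (t + 1) = density L l l' t := by
  unfold density
  rw [Int.fract_add_one]

lemma density_cases (h : IsTiling L l) (t : ℝ) : density L l l' t = 1 ∨
    ∃ x, ∃ s ∈ Ioo 0 (l x), density L l l' t = yoccozDeriv (l x) (l' x) s := by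
  by_cases hs : ∃ x, ∃ n : ℤ, t - n ∈ Ioo (L x) (L x + l x)
  · obtain ⟨x, n, hx⟩ := hs
    exact .inr ⟨x, t - n - L x, ⟨by linarith [hx.1], by linarith [hx.2]⟩, h.density_of_mem hx⟩
  · push Not at hs
    exact .inl (density_of_notMem hs)

lemma density_pos (h : IsTiling L l) (hl' : ∀ x, 0 < l' x) (t : ℝ) : 0 < density L l l' t := by
  rcases h.density_cases (l' := l') t with e | ⟨x, s, _, e⟩
  · rw [e]; exact one_pos
  · rw [e]; exact yoccozDeriv_pos (h.pos x) (hl' x) _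

/-- Points in a common lifted tile are compared directly. Otherwise both values are compared with 1,
the value at tile ends and off the tiles; each comparison spans at most `t - s`, hence the factor 2.
-/
lemma abs_density_sub_le (h : IsTiling L l) {τ : ℝ → ℝ} (hτ0 : ∀ t, 0 < t → 0 < τ t)
    (hτ : ∀ s t, 0 < s → s ≤ t → τ s ≤ τ t) {K : ℝ} (hK0 : 0 ≤ K)
    (hK : ∀ x, ∀ u ∈ Icc 0 (l x), ∀ v ∈ Icc 0 (l x), u < v →
      |yoccozDeriv (l x) (l' x) u - yoccozDeriv (l x) (l' x) v| ≤ K * τ (v - u))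
    {s t : ℝ} (hst : s < t) :
    |density L l l' s - density L l l' t| ≤ 2 * K * τ (t - s) := by
  have hτp := hτ0 (t - s) (sub_pos.2 hst)
  by_cases hA : ∃ x, ∃ n : ℤ, s - n ∈ Ioo (L x) (L x + l x) ∧ t - n ∈ Ioo (L x) (L x + l x)
  · obtain ⟨x, n, hs, ht⟩ := hA
    rw [h.density_of_mem hs, h.density_of_mem ht]
    refine (hK x _ ⟨by linarith [hs.1], by linarith [hs.2]⟩ _
      ⟨by linarith [ht.1], by linarith [ht.2]⟩ (by linarith)).trans ?_
    have e : t - n - L x - (s - n - L x) = t - s := by ring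
    rw [e]
    nlinarith [mul_nonneg hK0 hτp.le]
  have h1 : |density L l l' s - 1| ≤ K * τ (t - s) := by
    by_cases hs : ∃ x, ∃ n : ℤ, s - n ∈ Ioo (L x) (L x + l x)
    · obtain ⟨x, n, hs⟩ := hs
      have ht : L x + l x ≤ t - n := by
        by_contra hlt
        exact hA ⟨x, n, hs, by linarith [hs.1], by linarith⟩
      rw [h.density_of_mem hs, ← yoccozDeriv_end (b := l' x) (h.pos x)]
      have hlt : s - n - L x < l x := by linarith [hs.2]
      refine (hK x _ ⟨by linarith [hs.1], hlt.le⟩ _ ⟨(h.pos x).le, le_rfl⟩ hlt).trans ?_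
      exact mul_le_mul_of_nonneg_left (hτ _ _ (by linarith) (by linarith)) hK0
    · push Not at hs
      rw [density_of_notMem hs, sub_self, abs_zero]
      exact mul_nonneg hK0 hτp.le
  have h2 : |density L l l' t - 1| ≤ K * τ (t - s) := by
    by_cases ht : ∃ x, ∃ n : ℤ, t - n ∈ Ioo (L x) (L x + l x)
    · obtain ⟨x, n, ht⟩ := ht
      have hs : s - n ≤ L x := by
        by_contra hlt
        exact hA ⟨x, n, ⟨by linarith, by linarith [ht.2]⟩, ht⟩
      rw [h.density_of_mem ht, ← yoccozDeriv_zero (a := l x) (b := l' x), abs_sub_comm]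
      have hlt : 0 < t - n - L x := by linarith [ht.1]
      refine (hK x _ ⟨le_rfl, (h.pos x).le⟩ _ ⟨hlt.le, by linarith [ht.2]⟩ hlt).trans ?_
      exact mul_le_mul_of_nonneg_left (hτ _ _ (by linarith) (by linarith)) hK0
    · push Not at ht
      rw [density_of_notMem ht, sub_self, abs_zero]
      exact mul_nonneg hK0 hτp.le
  rw [abs_le] at *
  constructor <;> linarith [h1.1, h1.2, h2.1, h2.2]

/-- The intervals of a tiling cover almost all of the unit interval. -/
lemma volume_diff [Countable X] (h : IsTiling L l) :
    volume (Ioc (0 : ℝ) 1 \ ⋃ x, Ioo (L x) (L x + l x)) = 0 := by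
  have hd : Pairwise (Function.onFun Disjoint fun x => Ioo (L x) (L x + l x)) := by
    intro x y hxy
    exact Set.disjoint_left.2 fun t hx hy => hxy (h.unique hx hy)
  have hsub : (⋃ x, Ioo (L x) (L x + l x)) ⊆ Ioc (0 : ℝ) 1 :=
    iUnion_subset fun x t ht => ⟨(h.nonneg x).trans_lt ht.1, ht.2.le.trans (h.le_one x)⟩
  have hv : volume (⋃ x, Ioo (L x) (L x + l x)) = 1 := by
    rw [measure_iUnion hd fun x => measurableSet_Ioo]
    simp only [Real.volume_Ioo, add_sub_cancel_left]
    rw [← ENNReal.ofReal_tsum_of_nonneg (fun x => (h.pos x).le) h.hasSum.summable,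
      h.hasSum.tsum_eq, ENNReal.ofReal_one]
  rw [measure_sdiff hsub (MeasurableSet.iUnion fun x => measurableSet_Ioo).nullMeasurableSet
    (by rw [hv]; exact ENNReal.one_ne_top), hv, Real.volume_Ioc]
  simp

lemma integral_density_add (h : IsTiling L l) (x : X) {s : ℝ} (hs : s ∈ Icc 0 (l x)) :
    ∫ t in (L x)..(L x + s), density L l l' t = ∫ t in (0 : ℝ)..s, yoccozDeriv (l x) (l' x) t := by
  have h1 : ∫ t in (L x)..(L x + s), density L l l' t
      = ∫ t in (L x)..(L x + s), yoccozDeriv (l x) (l' x) (t - L x) := by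
    refine intervalIntegral.integral_congr_Ioo_of_le (by linarith [hs.1]) fun t ht => ?_
    have : t - ((0 : ℤ) : ℝ) ∈ Ioo (L x) (L x + l x) := by
      simpa using ⟨ht.1, ht.2.trans_le (by linarith [hs.2])⟩
    simpa using h.density_of_mem (l' := l') this
  rw [h1, intervalIntegral.integral_comp_sub_right (fun t => yoccozDeriv (l x) (l' x) t)]
  simp

open Classical in
-- When `r` cuts no tile, the tiles to its left fill `(0, r]` up to a null set, and the density
-- integrates over the tile of `y` to the target length `l' y`.
lemma integral_density [Countable X] (h : IsTiling L l) (hl' : ∀ x, 0 < l' x)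
    (hc : Continuous (density L l l')) {r : ℝ} (hr : r ∈ Icc (0 : ℝ) 1)
    (hcut : ∀ y, L y + l y ≤ r ∨ r ≤ L y) :
    ∫ t in (0 : ℝ)..r, density L l l' t = ∑' y, if L y < r then l' y else 0 := by
  let A : X → Set ℝ := fun y => if L y < r then Ioo (L y) (L y + l y) else ∅
  have hAsub : ∀ y, A y ⊆ Ioo (L y) (L y + l y) := by
    intro y
    simp only [A]
    split_ifs
    · exact Subset.rfl
    · exact empty_subset _
  have hA : (⋃ y, A y) ⊆ Ioc 0 r := by
    refine iUnion_subset fun y t ht => ?_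
    by_cases hy : L y < r
    · simp only [A, if_pos hy] at ht
      exact ⟨(h.nonneg y).trans_lt ht.1,
        ht.2.le.trans ((hcut y).resolve_right (not_le.2 hy))⟩
    · simp [A, if_neg hy] at ht
  have hAm : ∀ y, MeasurableSet (A y) := by
    intro y
    simp only [A]
    split_ifs
    · exact measurableSet_Ioo
    · exact MeasurableSet.empty
  have hAd : Pairwise (Function.onFun Disjoint A) := fun x y hxy =>
    Set.disjoint_left.2 fun t hx hy => hxy (h.unique (hAsub x hx) (hAsub y hy))
  have hnull : volume (Ioc 0 r \ ⋃ y, A y) = 0 := by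
    refine measure_mono_null ?_ h.volume_diff
    rintro t ⟨ht, htA⟩
    refine ⟨⟨ht.1, ht.2.trans hr.2⟩, fun hU => htA ?_⟩
    obtain ⟨y, hy⟩ := mem_iUnion.1 hU
    refine mem_iUnion.2 ⟨y, ?_⟩
    simpa only [A, if_pos (hy.1.trans_le ht.2)] using hy
  have hae : (⋃ y, A y) =ᵐ[volume] Ioc 0 r :=
    Filter.EventuallyLE.antisymm hA.eventuallyLE (ae_le_set.2 hnull)
  have hint : IntegrableOn (density L l l') (⋃ y, A y) := by
    refine IntegrableOn.mono_set ?_ hA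
    exact (hc.intervalIntegrable 0 r).1
  rw [intervalIntegral.integral_of_le hr.1, ← setIntegral_congr_set hae,
    ← (hasSum_integral_iUnion hAm hAd hint).tsum_eq]
  refine tsum_congr fun y => ?_
  simp only [A]
  split_ifs with hy
  · rw [← integral_Ioc_eq_integral_Ioo, ← intervalIntegral.integral_of_le (by linarith [h.pos y]),
      h.integral_density_add y ⟨(h.pos y).le, le_rfl⟩,
      integral_yoccozDeriv_total (h.pos y) (hl' y)]
  · simp

lemma integral_density_one [Countable X] (h : IsTiling L l) (hl' : ∀ x, 0 < l' x)
    (hs : HasSum l' 1) (hc : Continuous (density L l l')) :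
    ∫ t in (0 : ℝ)..1, density L l l' t = 1 := by
  classical
  rw [h.integral_density hl' hc (by simp) (fun y => .inl (h.le_one y))]
  exact (tsum_congr fun y => if_pos (by linarith [h.le_one y, h.pos y])).trans hs.tsum_eq

lemma integral_density_add_one [Countable X] (h : IsTiling L l) (hl' : ∀ x, 0 < l' x)
    (hs : HasSum l' 1) (hc : Continuous (density L l l')) (t : ℝ) :
    ∫ u in (0 : ℝ)..(t + 1), density L l l' u = (∫ u in (0 : ℝ)..t, density L l l' u) + 1 := by
  have hp : Function.Periodic (density L l l') 1 := density_add_one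
  rw [← intervalIntegral.integral_add_adjacent_intervals (hc.intervalIntegrable 0 t)
    (hc.intervalIntegrable t (t + 1)), hp.intervalIntegral_add_eq t 0, zero_add,
    h.integral_density_one hl' hs hc]

/-- The points in the intervals of a tiling are dense in the circle. -/
lemma dense_coe [Countable X] (h : IsTiling L l) :
    Dense {ξ : UnitAddCircle | ∃ x, ∃ s ∈ Ioo 0 (l x), ξ = ((L x + s : ℝ) : UnitAddCircle)} := by
  rw [dense_iff_inter_open]
  intro V hV hne
  obtain ⟨ξ, hξ⟩ := hne
  have hV' : IsOpen ((fun t : ℝ => (t : UnitAddCircle)) ⁻¹' V) :=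
    hV.preimage (AddCircle.continuous_mk' 1)
  obtain ⟨t, ht, rfl⟩ : ∃ t ∈ Icc (0 : ℝ) 1, (t : UnitAddCircle) = ξ := by
    refine ⟨AddCircle.equivIco 1 0 ξ, ?_, AddCircle.coe_equivIco⟩
    have := (AddCircle.equivIco (1 : ℝ) 0 ξ).2
    exact ⟨this.1, by simpa using this.2.le⟩
  have hcl : t ∈ closure (Ioo (0 : ℝ) 1) := by rwa [closure_Ioo (by norm_num)]
  have hW := hV'.inter (isOpen_Ioo (a := (0 : ℝ)) (b := 1))
  have hWne := mem_closure_iff.1 hcl _ hV' hξ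
  -- A nonempty open subset of `(0, 1)` has positive measure, so it cannot lie in the null
  -- complement of the tiles.
  have hpos := hW.measure_pos volume hWne
  by_contra hemp
  refine hpos.ne' (measure_mono_null ?_ h.volume_diff)
  rintro u ⟨huV, hu⟩
  refine ⟨⟨hu.1, hu.2.le⟩, fun hU => hemp ?_⟩
  obtain ⟨x, hx⟩ := mem_iUnion.1 hU
  exact ⟨u, huV, x, u - L x, ⟨by linarith [hx.1], by linarith [hx.2]⟩, by simp⟩

end IsTiling

lemma exists_circleMap {H : ℝ → ℝ} (hc : Continuous H) (hH : ∀ t, H (t + 1) = H t + 1) :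
    ∃ f : UnitAddCircle → UnitAddCircle, Continuous f ∧
      ∀ t : ℝ, f t = (H t : UnitAddCircle) := by
  have hp : Function.Periodic (fun t => (H t : UnitAddCircle)) 1 := by
    intro t
    simp only [hH, AddCircle.coe_add_period]
  refine ⟨hp.lift, ?_, fun t => hp.lift_coe t⟩
  refine (QuotientAddGroup.isQuotientMap_mk
    (N := AddSubgroup.zmultiples (1 : ℝ))).continuous_iff.2 ?_
  exact (AddCircle.continuous_mk' 1).comp hc

end Tiling

/-! ### The action on the circle -/

section Action

open Set

lemma isTiling_leftPos {X : Type*} {c : CyclicOrder X} {x₀ : X} {l : X → ℝ} (hl : ∀ x, 0 < l x)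
    (hs : HasSum l 1) : IsTiling (leftPos c x₀ l) l where
  pos := hl
  nonneg := leftPos_nonneg hl
  le_one := leftPos_add_le_one hl hs
  sep _ _ hxy := (CyclicOrder.Prec.total (c := c) (x₀ := x₀) hxy).imp
    (leftPos_add_le hl hs.summable) (leftPos_add_le hl hs.summable)
  hasSum := hs

lemma abs_sq_sub_one_le {q B : ℝ} (hq : |q - 1| ≤ B) : |q ^ 2 - 1| ≤ (2 + B) * B := by
  have e : q ^ 2 - 1 = (q - 1 + 2) * (q - 1) := by ring
  have hB := (abs_nonneg _).trans hq
  rw [e, abs_mul]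
  refine mul_le_mul ((abs_add_le _ _).trans ?_) hq (abs_nonneg _) (by linarith)
  rw [abs_of_pos (two_pos : (0 : ℝ) < 2)]
  linarith

/-- The derivatives in Yoccoz's family are uniformly of class `C^τ` when the ratios of the
lengths are controlled by `τ`. -/
lemma exists_yoccozDeriv_modulus {X : Type*} {l l' : X → ℝ} (hl : ∀ x, 0 < l x)
    (hl1 : ∀ x, l x ≤ 1) {τ : ℝ → ℝ}
    (hτ0 : ∀ t, 0 < t → 0 < τ t) (hτ : ∀ s t, 0 < s → s ≤ t → τ s ≤ τ t)
    (hτ' : ∀ s t, 0 < s → s ≤ t → τ t * s ≤ τ s * t)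
    {B : ℝ} (hB0 : 0 ≤ B) (hB : ∀ x, |l x / l' x - 1| ≤ B * τ (l x))
    {m : ℝ} (hm0 : 0 < m) (hm : ∀ x, m ≤ l x / l' x) :
    ∃ K, 0 ≤ K ∧ ∀ x, ∀ u ∈ Icc 0 (l x), ∀ v ∈ Icc 0 (l x), u < v →
      |yoccozDeriv (l x) (l' x) u - yoccozDeriv (l x) (l' x) v| ≤ K * τ (v - u) := by
  have hτ1 := hτ0 1 one_pos
  have hm' : 0 < min 1 (m ^ 2) := lt_min one_pos (by positivity)
  refine ⟨(2 + B * τ 1) * B / min 1 (m ^ 2) ^ 2 * Real.pi, ?_, ?_⟩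
  · have := Real.pi_pos
    positivity
  intro x u hu v hv huv
  have hτx := hτ0 _ (hl x)
  have h1 : |(l x / l' x) ^ 2 - 1| ≤ (2 + B * τ 1) * (B * τ (l x)) := by
    refine (abs_sq_sub_one_le (hB x)).trans (mul_le_mul_of_nonneg_right ?_ (by positivity))
    have := mul_le_mul_of_nonneg_left (hτ _ _ (hl x) (hl1 x)) hB0
    linarith
  have h2 : min 1 (m ^ 2) ≤ (l x / l' x) ^ 2 :=
    (min_le_right _ _).trans (pow_le_pow_left₀ hm0.le (hm x) 2)
  refine (abs_yoccozDeriv_sub_le (hl x) hm' (min_le_left _ _) h2 u v).trans ?_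
  rw [abs_sub_comm u v, abs_of_pos (sub_pos.2 huv)]
  -- Monotonicity of `τ t / t` trades the smallness of the ratio defect for the factor `1 / l x` in
  -- the Lipschitz constant.
  have h3 : τ (l x) * (v - u) ≤ τ (v - u) * l x :=
    hτ' _ _ (sub_pos.2 huv) (by linarith [hu.1, hv.2])
  have hp := Real.pi_pos
  have hx := hl x
  calc |(l x / l' x) ^ 2 - 1| / min 1 (m ^ 2) ^ 2 * (Real.pi / l x) * (v - u)
      ≤ (2 + B * τ 1) * (B * τ (l x)) / min 1 (m ^ 2) ^ 2 * (Real.pi / l x) * (v - u) := by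
        gcongr
    _ = (2 + B * τ 1) * B / min 1 (m ^ 2) ^ 2 * (Real.pi / l x) * (τ (l x) * (v - u)) := by ring
    _ ≤ (2 + B * τ 1) * B / min 1 (m ^ 2) ^ 2 * (Real.pi / l x) * (τ (v - u) * l x) := by
        gcongr
    _ = _ := by field_simp

/-- A cyclically ordered `G`-set with lengths whose ratios are controlled by `τ` is realized by
intervals of the circle that are permuted by `G` through diffeomorphisms of class `C^{1,τ}`. -/
theorem exists_action {G X : Type*} [Group G] [Countable X] [Nonempty X] [MulAction G X]
    (c : CyclicOrder X) (hc : ∀ g : G, CyclicOrderPreserving c c (fun x : X => g • x))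
    {l : X → ℝ} (hl : ∀ x, 0 < l x) (hs : HasSum l 1) {τ : ℝ → ℝ}
    (hτ0 : ∀ t, 0 < t → 0 < τ t) (hτ : ∀ s t, 0 < s → s ≤ t → τ s ≤ τ t)
    (hτ' : ∀ s t, 0 < s → s ≤ t → τ t * s ≤ τ s * t) (hτlim : Tendsto τ (𝓝 0) (𝓝 0))
    (hB : ∀ g : G, ∃ B, 0 ≤ B ∧ ∀ x, |l x / l (g • x) - 1| ≤ B * τ (l x))
    (hm : ∀ g : G, ∃ m, 0 < m ∧ ∀ x, m ≤ l x / l (g • x)) :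
    ∃ (ρ : G →* (UnitAddCircle ≃ₜ UnitAddCircle)) (J : X → OpenInterval),
      (∀ g, ρ g ∈ DiffPlus) ∧
      (∀ g, ∃ K, ∀ ξ η, ξ ≠ η → |circleDeriv (ρ g) ξ - circleDeriv (ρ g) η| ≤ K * τ (dist ξ η)) ∧
      (∀ g ξ, circleDeriv (ρ g) ξ = 1 ∨
        ∃ x s, circleDeriv (ρ g) ξ = yoccozDeriv (l x) (l (g • x)) s) ∧
      (∀ x y : X, x ≠ y → Disjoint (J x).carrier (J y).carrier) ∧
      Dense (⋃ x : X, (J x).carrier) ∧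
      CyclicOrderPreserving c circleOrder (fun x => (J x).left) ∧
      CyclicOrderPreserving c circleOrder (fun x => (J x).right) ∧
      (∀ (g : G) (x : X), ρ g '' (J x).carrier = (J (g • x)).carrier) ∧
      (∀ (g : G) (x : X), g • x = x → ∀ ξ ∈ (J x).carrier, ρ g ξ = ξ) := by
  classical
  obtain ⟨x₀⟩ := ‹Nonempty X›
  set L := leftPos c x₀ l
  have hT : IsTiling L l := isTiling_leftPos hl hs
  have hl1 : ∀ x, l x ≤ 1 := fun x => by linarith [hT.nonneg x, hT.le_one x]
  let l' : G → X → ℝ := fun g x => l (g • x)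
  have hl' : ∀ g x, 0 < l' g x := fun g x => hl _
  have hs' : ∀ g, HasSum (l' g) 1 := fun g => (MulAction.toPerm g).hasSum_iff.2 hs
  let D : G → ℝ → ℝ := fun g => density L l (l' g)
  have hD : ∀ g, ∃ K, 0 ≤ K ∧ ∀ s t, s < t → |D g s - D g t| ≤ K * τ (t - s) := by
    intro g
    obtain ⟨B, hB0, hB⟩ := hB g
    obtain ⟨m, hm0, hm⟩ := hm g
    obtain ⟨K, hK0, hK⟩ := exists_yoccozDeriv_modulus hl hl1 hτ0 hτ hτ' (l' := l' g) hB0 hB hm0 hm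
    exact ⟨2 * K, by positivity, fun s t hst => hT.abs_density_sub_le hτ0 hτ hK0 hK hst⟩
  have hDc : ∀ g, Continuous (D g) := by
    intro g
    obtain ⟨K, hK0, hK⟩ := hD g
    have hτ00 : τ 0 = 0 := eq_of_tendsto_nhds hτlim
    refine continuous_iff_continuousAt.2 fun t => ?_
    rw [ContinuousAt, tendsto_iff_dist_tendsto_zero]
    have hlim : Tendsto (fun s => K * τ |s - t|) (𝓝 t) (𝓝 0) := by
      have h1 : Tendsto (fun s => |s - t|) (𝓝 t) (𝓝 0) := by
        have : Continuous fun s : ℝ => |s - t| := by fun_prop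
        simpa using this.tendsto t
      simpa using (hτlim.comp h1).const_mul K
    refine squeeze_zero (fun s => dist_nonneg) (fun s => ?_) hlim
    rw [Real.dist_eq]
    rcases lt_trichotomy s t with h | h | h
    · rw [abs_sub_comm s t, abs_of_pos (sub_pos.2 h)]
      exact hK _ _ h
    · simp [h, hτ00]
    · rw [abs_of_pos (sub_pos.2 h), abs_sub_comm]
      exact hK _ _ h
  -- The lift starts at `L (g • x₀)` because `x₀` comes first in the cut order, so its tile begins
  -- at 0.
  let H : G → ℝ → ℝ := fun g t => L (g • x₀) + ∫ u in (0 : ℝ)..t, D g u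
  have hHd : ∀ g t, HasDerivAt (H g) (D g t) t := fun g t =>
    (intervalIntegral.integral_hasDerivAt_right ((hDc g).intervalIntegrable _ _)
      (hDc g).stronglyMeasurable.stronglyMeasurableAtFilter (hDc g).continuousAt).const_add _
  have hHc : ∀ g, Continuous (H g) := fun g =>
    continuous_iff_continuousAt.2 fun t => (hHd g t).continuousAt
  have hH1 : ∀ g t, H g (t + 1) = H g t + 1 := by
    intro g t
    simp only [H, D, hT.integral_density_add_one (hl' g) (hs' g) (hDc g), add_assoc]
  choose f hfc hf using fun g => exists_circleMap (hHc g) (hH1 g)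
  have hfJ : ∀ g x, ∀ s ∈ Ioo 0 (l x), f g ((L x + s : ℝ) : UnitAddCircle)
      = ((L (g • x) + yoccozMap (l x) (l (g • x)) s : ℝ) : UnitAddCircle) := by
    intro g x s hs0
    have e1 : ∫ u in (0 : ℝ)..(L x), D g u = leftPos c x₀ (l ∘ MulAction.toPerm g) x := by
      rw [hT.integral_density (hl' g) (hDc g)
        ⟨hT.nonneg x, by linarith [hT.le_one x, hl x]⟩ fun y => ?_]
      · simp only [L, leftPos_lt_iff hl hs.summable]
        rfl
      · by_cases hxy : y = x
        · subst hxy; exact .inr le_rfl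
        · exact (hT.sep y x hxy).imp_right fun h => by linarith [hl x]
    have e2 : ∫ u in (0 : ℝ)..(L x + s), D g u
        = leftPos c x₀ (l ∘ MulAction.toPerm g) x + yoccozMap (l x) (l (g • x)) s := by
      rw [← intervalIntegral.integral_add_adjacent_intervals ((hDc g).intervalIntegrable 0 (L x))
        ((hDc g).intervalIntegrable (L x) (L x + s)), e1,
        hT.integral_density_add x ⟨hs0.1.le, hs0.2.le⟩,
        integral_yoccozDeriv (hl x) (hl' g x) hs0]
    have e3 := coe_leftPos_equiv (x₀ := x₀) hl hs (MulAction.toPerm g) (hc g) x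
    rw [hf]
    simp only [H, e2]
    rw [← add_assoc, AddCircle.coe_add _ (_ + _), AddCircle.coe_add _ (L _)]
    exact congrArg (· + _) e3
  -- The identity and composition laws are known on the tiles, which are dense, and extend by
  -- continuity. The inverse of `f g` is then `f g⁻¹`, which has the same regularity.
  have hone : f 1 = id := by
    refine Continuous.ext_on hT.dense_coe (hfc 1) continuous_id ?_
    rintro ξ ⟨x, s, hs0, rfl⟩
    rw [hfJ 1 x s hs0, one_smul, yoccozMap_self (hl x) hs0, id]
  have hmul : ∀ g h, f (g * h) = f g ∘ f h := by
    intro g h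
    refine Continuous.ext_on hT.dense_coe (hfc _) ((hfc g).comp (hfc h)) ?_
    rintro ξ ⟨x, s, hs0, rfl⟩
    rw [hfJ _ x s hs0, Function.comp_apply, hfJ h x s hs0,
      hfJ g (h • x) _ (yoccozMap_mem (hl _) s), yoccozMap_comp (hl _), mul_smul]
  have hinv : ∀ g ξ, f g⁻¹ (f g ξ) = ξ := by
    intro g ξ
    rw [← Function.comp_apply (f := f g⁻¹), ← hmul, inv_mul_cancel, hone, id]
  let φ : G → UnitAddCircle ≃ₜ UnitAddCircle := fun g =>
    { toFun := f g
      invFun := f g⁻¹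
      left_inv := hinv g
      right_inv := fun ξ => by simpa using hinv g⁻¹ ξ
      continuous_toFun := hfc g
      continuous_invFun := hfc g⁻¹ }
  let ρ : G →* (UnitAddCircle ≃ₜ UnitAddCircle) :=
    { toFun := φ
      map_one' := by ext ξ; exact congrFun hone ξ
      map_mul' := fun g h => by ext ξ; exact congrFun (hmul g h) ξ }
  have hDer : ∀ g (t : ℝ), circleDeriv (f g) t = D g t := fun g t => circleDeriv_coe (hf g) (hHd g t)
  let J : X → OpenInterval := fun x =>
    { a := L x
      b := L x + l x
      lt := by linarith [hl x]
      le := by linarith [hl1 x] }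
  have hJ : ∀ x ξ, ξ ∈ (J x).carrier ↔ ∃ s ∈ Ioo 0 (l x), ((L x + s : ℝ) : UnitAddCircle) = ξ := by
    intro x ξ
    constructor
    · rintro ⟨t, ht, rfl⟩
      exact ⟨t - L x, ⟨by linarith [ht.1], by linarith [ht.2]⟩, by simp⟩
    · rintro ⟨s, hs0, rfl⟩
      exact ⟨L x + s, ⟨by linarith [hs0.1], by linarith [hs0.2]⟩, rfl⟩
  have hsub : ∀ g x ξ, ξ ∈ (J x).carrier → f g ξ ∈ (J (g • x)).carrier := by
    intro g x ξ hξ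
    obtain ⟨s, hs0, rfl⟩ := (hJ _ _).1 hξ
    exact (hJ _ _).2 ⟨_, yoccozMap_mem (hl _) s, (hfJ g x s hs0).symm⟩
  refine ⟨ρ, J, fun g => ⟨isCircleC1_of_lift (hf g) (hHd g) (hDc g),
    isCircleC1_of_lift (hf g⁻¹) (hHd g⁻¹) (hDc g⁻¹), fun ξ => ?_⟩, fun g => ?_, fun g ξ => ?_,
    fun x y hxy => ?_, ?_, leftPos_preserving hl hs, rightPos_preserving hl hs, fun g x => ?_,
    fun g x hgx ξ hξ => ?_⟩
  · change 0 < circleDeriv (f g) ξ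
    induction ξ using QuotientAddGroup.induction_on with
    | H t => exact (hT.density_pos (hl' g) t).trans_eq (hDer g t).symm
  · obtain ⟨K, hK0, hK⟩ := hD g
    refine ⟨K, fun ξ η hne => ?_⟩
    change |circleDeriv (f g) ξ - circleDeriv (f g) η| ≤ _
    induction η using QuotientAddGroup.induction_on with
    | H t =>
      obtain ⟨s, rfl, hst⟩ := exists_lift_dist ξ t
      refine ((congrArg abs (congrArg₂ (· - ·) (hDer g s) (hDer g t))).trans_le ?_).trans_eq
        (congrArg (fun d => K * τ d) hst)
      rcases lt_trichotomy s t with h | h | h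
      · rw [abs_sub_comm s t, abs_of_pos (sub_pos.2 h)]
        exact hK _ _ h
      · exact absurd (congrArg _ h) hne
      · rw [abs_of_pos (sub_pos.2 h), abs_sub_comm]
        exact hK _ _ h
  · change circleDeriv (f g) ξ = 1 ∨ ∃ x s, circleDeriv (f g) ξ = _
    induction ξ using QuotientAddGroup.induction_on with
    | H t =>
      rcases hT.density_cases (l' := l' g) t with e | ⟨x, s, _, e⟩
      · exact .inl ((hDer g t).trans e)
      · exact .inr ⟨x, s, (hDer g t).trans e⟩
  · rw [Set.disjoint_left]
    rintro _ ⟨s, hs0, rfl⟩ ⟨t, ht, hst⟩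
    have hmem : ∀ z, ∀ r ∈ Ioo (L z) (L z + l z), r ∈ Ico (0 : ℝ) (0 + 1) := fun z r hr =>
      ⟨(hT.nonneg z).trans hr.1.le, by linarith [hr.2, hT.le_one z]⟩
    have := (AddCircle.coe_eq_coe_iff_of_mem_Ico (hmem y t ht) (hmem x s hs0)).1 hst
    subst this
    exact hxy (hT.unique hs0 ht)
  · refine hT.dense_coe.mono ?_
    rintro ξ ⟨x, s, hs0, rfl⟩
    exact mem_iUnion.2 ⟨x, (hJ _ _).2 ⟨s, hs0, rfl⟩⟩
  · refine Set.Subset.antisymm (Set.image_subset_iff.2 fun ξ hξ => hsub g x ξ hξ) fun ξ hξ => ?_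
    refine ⟨f g⁻¹ ξ, ?_, (φ g).right_inv ξ⟩
    simpa using hsub g⁻¹ _ ξ hξ
  · obtain ⟨s, hs0, rfl⟩ := (hJ _ _).1 hξ
    refine (hfJ g x s hs0).trans ?_
    rw [hgx, yoccozMap_self (hl x) hs0]

end Action

/-! ### Moduli of continuity -/

/-- Taken in `EReal`, a limsup below `⊤` does give an eventual real bound, and the finitely many
remaining terms are absorbed. -/
lemma exists_bound_of_limsup_lt_top {u : ℕ → ℝ}
    (h : limsup (fun n => (u n : EReal)) atTop < ⊤) : ∃ C, 0 ≤ C ∧ ∀ n, u n ≤ C := by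
  obtain ⟨C, hC, -⟩ := EReal.lt_iff_exists_real_btwn.1 h
  have h1 : ∀ᶠ n in atTop, u n ≤ C := by
    filter_upwards [eventually_lt_of_limsup_lt hC] with n hn
    exact (EReal.coe_lt_coe_iff.1 hn).le
  have h2 : IsBoundedUnder (· ≤ ·) atTop u := ⟨C, h1⟩
  obtain ⟨B, hB⟩ := h2.bddAbove_range
  exact ⟨max B 0, le_max_right _ _, fun n => (hB ⟨n, rfl⟩).trans (le_max_left _ _)⟩

lemma modulus_zero (σ : ℝ≥0 ≃ₜ ℝ≥0) (hσ : StrictMono σ) : σ 0 = 0 := by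
  obtain ⟨t, ht⟩ := σ.surjective 0
  have := hσ.monotone (zero_le : 0 ≤ t)
  rw [ht] at this
  exact le_antisymm this zero_le

/-- A homeomorphism of `[0, ∞)` is increasing. -/
lemma modulus_strictMono (σ : ℝ≥0 ≃ₜ ℝ≥0) : StrictMono σ := by
  refine (σ.continuous.strictMono_of_inj σ.injective).resolve_right fun h => ?_
  obtain ⟨t, ht⟩ := σ.surjective (σ 0 + 1)
  have h1 := h.antitone (zero_le : 0 ≤ t)
  rw [ht] at h1
  exact absurd h1 (not_le.2 (lt_add_one _))

end CircleAction

theorem proposition4p1 {G X : Type*} [Group G] [Countable G] [Countable X] [Nonempty X]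
    [MulAction G X]
    -- `(X, c)` is a cyclically ordered `G`-set with subexponential growth of orbits
    (c : CircleAction.CyclicOrder X)
    (hc : ∀ g : G, CircleAction.CyclicOrderPreserving c c (fun x : X => g • x))
    (hX : CircleAction.SubexpGrowthOfOrbits G X)
    -- the growth function `F : ℕ → [1, ∞)`
    (F : ℕ → ℝ≥0) (hF1 : ∀ n, 1 ≤ F n) (hFmono : Monotone F)
    (hFlim : Tendsto (fun n : ℕ => (F (n + 1) : ℝ) / (F n : ℝ)) atTop (𝓝 1))
    (hFsum : ∀ (S : Finset G) (x : X),
      Summable (fun n : ℕ => (CircleAction.orbitGrowth S x n : ℝ) / (F n : ℝ)))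
    -- the modulus of continuity
    (σ : ℝ≥0 ≃ₜ ℝ≥0) (hσ : AntitoneOn (fun t : ℝ≥0 => σ t / t) (Set.Ioi 0))
    (hσF : limsup (fun n : ℕ =>
      ((|(F (n + 1) : ℝ) / (F n : ℝ) - 1| * (1 / (σ ((F n)⁻¹) : ℝ)) : ℝ) : EReal)) atTop < ⊤) :
    ∀ (S : Finset G) (ε : ℝ), 0 < ε →
      ∃ (ρ : G →* (UnitAddCircle ≃ₜ UnitAddCircle)) (J : X → CircleAction.OpenInterval),
        (∀ g : G, ρ g ∈ CircleAction.DiffPlusMod σ) ∧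
        -- (i)
        (∀ x y : X, x ≠ y → Disjoint (J x).carrier (J y).carrier) ∧
        Dense (⋃ x : X, (J x).carrier) ∧
        -- (ii)
        CircleAction.CyclicOrderPreserving c CircleAction.circleOrder (fun x => (J x).left) ∧
        CircleAction.CyclicOrderPreserving c CircleAction.circleOrder (fun x => (J x).right) ∧
        -- (iii)
        (∀ (g : G) (x : X), ρ g '' (J x).carrier = (J (g • x)).carrier) ∧
        (∀ (g : G) (x : X), g • x = x → ∀ ξ ∈ (J x).carrier, ρ g ξ = ξ) ∧
        -- closeness of the derivatives to `1`
        (∀ s ∈ S, (⨆ ξ : UnitAddCircle, |CircleAction.circleDeriv (ρ s) ξ - 1|) < ε) := by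
  intro S ε hε
  have hσm := CircleAction.modulus_strictMono σ
  have hσ0 := CircleAction.modulus_zero σ hσm
  -- The modulus as a function on `ℝ`, extended by 0 to the negatives; continuity at 0 follows from
  -- `σ 0 = 0`.
  set τ : ℝ → ℝ := fun t => σ t.toNNReal with hτdef
  have hτ0 : ∀ t, 0 < t → 0 < τ t := by
    intro t ht
    have := hσm (Real.toNNReal_pos.2 ht)
    rw [hσ0] at this
    exact_mod_cast this
  have hτ : ∀ s t, 0 < s → s ≤ t → τ s ≤ τ t := fun s t _ hst =>
    NNReal.coe_le_coe.2 (hσm.monotone (Real.toNNReal_le_toNNReal hst))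
  have hτ' : ∀ s t, 0 < s → s ≤ t → τ t * s ≤ τ s * t := by
    intro s t hs hst
    have ht := hs.trans_le hst
    have h := hσ (Set.mem_Ioi.2 (Real.toNNReal_pos.2 hs)) (Set.mem_Ioi.2 (Real.toNNReal_pos.2 ht))
      (Real.toNNReal_le_toNNReal hst)
    have h' := NNReal.coe_le_coe.2 h
    simp only [NNReal.coe_div, Real.coe_toNNReal _ hs.le, Real.coe_toNNReal _ ht.le] at h'
    exact (div_le_div_iff₀ ht hs).1 h'
  have hτlim : Tendsto τ (𝓝 0) (𝓝 0) := by
    have hc : Continuous τ :=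
      NNReal.continuous_coe.comp (σ.continuous.comp continuous_real_toNNReal)
    have := hc.tendsto 0
    simpa [hτdef, hσ0] using this
  have hFpos : ∀ n, 0 < (F n : ℝ) := fun n => by exact_mod_cast one_pos.trans_le (hF1 n)
  have hτF : ∀ n, τ (1 / F n) = σ (F n)⁻¹ := by
    intro n
    have : (1 / (F n : ℝ)).toNNReal = (F n)⁻¹ := by
      rw [one_div, ← NNReal.coe_inv, Real.toNNReal_coe]
    simp only [hτdef, this]
  obtain ⟨C, hC0, hC⟩ := CircleAction.exists_bound_of_limsup_lt_top hσF
  have hC' : ∀ n, (F (n + 1) : ℝ) / F n - 1 ≤ C * τ (1 / F n) := by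
    intro n
    have hp := hτ0 (1 / F n) (one_div_pos.2 (hFpos n))
    have h := hC n
    rw [← hτF, mul_one_div, div_le_iff₀ hp] at h
    exact (le_abs_self _).trans h
  -- From `δ ≤ 1 / 2` the ratio is at least `1 / 2`, so its square is at least `1 / 4`. The
  -- derivative then differs from 1 by at most `4 * (2 + δ) * δ ≤ 10 * δ ≤ ε / 2`, which leaves room
  -- for a strict bound on the supremum.
  set δ := min (1 / 2) (ε / 20)
  have hδ0 : 0 < δ := lt_min (by norm_num) (by positivity)
  obtain ⟨l, hl, hs, hB, hm, hS⟩ := CircleAction.exists_lengths (X := X) hFpos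
    (fun _ _ h => NNReal.coe_le_coe.2 (hFmono h)) hFlim hFsum hτ0 hτ hτ' hC0 hC' S hδ0
  obtain ⟨ρ, J, h1, h2, h3, h4, h5, h6, h7, h8, h9⟩ :=
    CircleAction.exists_action c hc hl hs hτ0 hτ hτ' hτlim hB hm
  refine ⟨ρ, J, fun g => ⟨h1 g, ?_⟩, h4, h5, h6, h7, h8, h9, fun s hsS => ?_⟩
  · obtain ⟨K, hK⟩ := h2 g
    refine ⟨K, ?_⟩
    rintro _ ⟨ξ, η, hne, rfl⟩
    have hp := hτ0 _ (dist_pos.2 hne)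
    have e : ((σ (nndist ξ η) : ℝ≥0) : ℝ) = τ (dist ξ η) := by
      simp only [hτdef, dist_nndist, Real.toNNReal_coe]
    rw [e, Real.dist_eq, div_le_iff₀ hp]
    exact hK ξ η hne
  · refine (ciSup_le fun ξ => ?_).trans_lt (half_lt_self hε)
    rcases h3 s ξ with e | ⟨x, t, e⟩
    · rw [e, sub_self, abs_zero]
      positivity
    · rw [e]
      have hq := hS s hsS x
      have hδ1 : δ ≤ 1 / 2 := min_le_left _ _
      have hδ2 : δ ≤ ε / 20 := min_le_right _ _
      have hq1 : 1 / 2 ≤ l x / l (s • x) := by linarith [(abs_le.1 hq).1]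
      have hq2 : (1 / 4 : ℝ) ≤ (l x / l (s • x)) ^ 2 := by nlinarith
      have hq3 := CircleAction.abs_sq_sub_one_le hq
      refine (CircleAction.abs_yoccozDeriv_sub_one_le (by norm_num) (by norm_num) hq2 t).trans ?_
      rw [div_le_iff₀ (by norm_num)]
      refine hq3.trans ?_
      nlinarith
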